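/- For $m\ge 1$ let $K=\mathbb Q(\zeta_m)$ be the $m$-th cyclotomic field, with ring of integers $\mathcal O_K$, discriminant $d_K$ and degree $\phi(m)$, and let $K_{\mathbb R}=K\otimes_{\mathbb Q}\mathbb R$ be the Euclidean space of dimension $\phi(m)$ whose scalar product is induced by the trace form $\langle x,y\rangle=\mathrm{tr}(x\overline y)=\sum_{\tau:K\to\mathbb C}\tau(x)\overline{\tau(y)}$. Let $E=K_{\mathbb R}^2$ with the scalar product $\langle x,y\rangle=\langle x_1,y_1\rangle+\langle x_2,y_2\rangle$; it is a Euclidean space of dimension $2\phi(m)$. In a Euclidean space of dimension $n$, the dual of a lattice $\Lambda$ is $\Lambda^\#=\{x:\langle x,y\rangle\in\mathbb Z\ \forall y\in\Lambda\}$. The lattice $\Lambda$ is called symplectic if there is an isometry $\sigma$ of the space with $\sigma(\Lambda)=\Lambda^\#$ and $\sigma^2=-\mathrm{Id}$. Its packing density is $\Delta(\Lambda)=\mathrm{Vol}(B(\mu))/(2^n\,\mathrm{Vol}(\Lambda))$, where $\mu=\min\{\|x\|: x\in\Lambda\setminus\{0\}\}$, $B(\mu)$ is the ball of radius $\mu$,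 and $\mathrm{Vol}(\Lambda)$ is the volume of a fundamental region. For every $m\ge1$ let $\mathfrak P=\mathfrak P_m$ be a prime ideal of $\mathcal O_K$ lying over a prime number that does not divide $m$, and put $F=\mathcal O_K/\mathfrak P$ and $q=q_m=|F|$. Let $\alpha=(q|d_K|)^{1/(2\phi(m))}$, let $\mathcal O_K^\#$ be the dual lattice of $\mathcal O_K$ in $K_{\mathbb R}$, and let $$\Lambda_0=\alpha^{-1}\mathcal O_K\times\alpha\,\mathfrak P^{-1}\mathcal O_K^\#\subset E .$$ With $\pi:\Lambda_0\to\Lambda_0/\mathfrak P\Lambda_0$ the canonical surjection, let $\mathcal L_{\mathcal C}=\mathcal L_{\mathcal C,m}$ be the family of the lattices $\Lambda_C=\pi^{-1}(C)$, where $C$ runs over the one-dimensional $F$-subspaces of the $F$-vector space $\Lambda_0/\mathfrak P\Lambda_0$. Theorem. Let $0<\varepsilon<1$, and suppose that $\phi(m)^2m=o\big(q_m^{1/\phi(m)}\big)$ as $m\to\infty$. Then for all sufficiently large $m$, every lattice in $\mathcal L_{\mathcal C}$ is a symplectic lattice of $E\cong\mathbb R^{2\phi(m)}$, and $\mathcal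 L_{\mathcal C}$ contains a lattice $\Lambda$ with $$\Delta(\Lambda)>\frac{(1-\varepsilon)\,m}{2^{2\phi(m)}} .$$ -/

import Mathlib

open scoped NumberField TensorProduct ComplexConjugate Pointwise
open Filter Asymptotics MeasureTheory

noncomputable section

/-! ## Lattices in Euclidean spaces -/

section Lattices

variable {E : Type*} [NormedAddCommGroup E] [InnerProductSpace ℝ E]

/-- A lattice in `E`: a discrete subgroup that spans `E` over `ℝ` (equivalently, in finite
dimension `n`, a discrete free `ℤ`-module of rank `n`). -/
def IsEuclideanLattice (Λ : Submodule ℤ E) : Prop :=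
  DiscreteTopology Λ ∧ Submodule.span ℝ (Λ : Set E) = ⊤

/-- The dual lattice `Λ^# = {x | ∀ y ∈ Λ, ⟪x, y⟫ ∈ ℤ}`. -/
def dualLattice (Λ : Submodule ℤ E) : Submodule ℤ E where
  carrier := {x | ∀ y ∈ Λ, ∃ k : ℤ, inner ℝ x y = (k : ℝ)}
  zero_mem' := fun y _ => ⟨0, by simp⟩
  add_mem' := by
    intro a b ha hb y hy
    obtain ⟨k, hk⟩ := ha y hy
    obtain ⟨l, hl⟩ := hb y hy
    exact ⟨k + l, by rw [inner_add_left, hk, hl]; push_cast; rfl⟩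
  smul_mem' := by
    intro c x hx y hy
    obtain ⟨k, hk⟩ := hx y hy
    refine ⟨c * k, ?_⟩
    rw [← Int.cast_smul_eq_zsmul ℝ c x, real_inner_smul_left, hk]
    push_cast
    rfl

/-- A lattice `Λ` is symplectic if there is an isometry `σ` of `E` with `σ(Λ) = Λ^#` and
`σ² = -Id`. -/
def IsSymplecticLattice (Λ : Submodule ℤ E) : Prop :=
  IsEuclideanLattice Λ ∧
    ∃ σ : E ≃ₗᵢ[ℝ] E, σ '' (Λ : Set E) = (dualLattice Λ : Set E) ∧ ∀ x, σ (σ x) = -x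

/-- The minimum `μ_Λ = min {‖x‖ | x ∈ Λ \ {0}}`. -/
def latticeMinimum (Λ : Submodule ℤ E) : ℝ :=
  sInf {r : ℝ | ∃ x ∈ Λ, x ≠ 0 ∧ r = ‖x‖}

/-- The packing density `Δ(Λ) = Vol(B(μ_Λ)) / (2^n Vol(Λ))`, where `n = dim E` and `Vol(Λ)` is the
volume of a fundamental region. -/
def latticeDensity [FiniteDimensional ℝ E] [MeasurableSpace E] [BorelSpace E]
    (Λ : Submodule ℤ E) : ℝ :=
  (volume : Measure E).real (Metric.closedBall 0 (latticeMinimum Λ)) /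
    (2 ^ Module.finrank ℝ E * ZLattice.covolume Λ)

end Lattices

/-! ## The Euclidean space `K_ℝ` of a number field -/

/-- `K_ℝ = ℝ ⊗ K`. -/
def RealSpace (K : Type*) [Field K] [NumberField K] : Type _ := ℝ ⊗[ℚ] K

namespace RealSpace

variable (K : Type*) [Field K] [NumberField K]

instance : CommRing (RealSpace K) := inferInstanceAs (CommRing (ℝ ⊗[ℚ] K))

instance : Algebra ℝ (RealSpace K) := inferInstanceAs (Algebra ℝ (ℝ ⊗[ℚ] K))

/-- The natural embedding `K → K_ℝ`, `x ↦ 1 ⊗ x`. -/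
instance : Algebra K (RealSpace K) :=
  (Algebra.TensorProduct.includeRight : K →ₐ[ℚ] ℝ ⊗[ℚ] K).toRingHom.toAlgebra

instance : Module.Finite ℝ (RealSpace K) := inferInstanceAs (Module.Finite ℝ (ℝ ⊗[ℚ] K))

variable {K}

theorem algebraMap_eq (x : K) : algebraMap K (RealSpace K) x = (1 : ℝ) ⊗ₜ[ℚ] x := rfl

/-- The `ℝ`-algebra homomorphism `K_ℝ → ℂ` that extends an embedding `τ : K → ℂ`. -/
def embed (τ : K →+* ℂ) : RealSpace K →ₐ[ℝ] ℂ :=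
  Algebra.TensorProduct.lift (Algebra.ofId ℝ ℂ) τ.toRatAlgHom (fun _ _ => Commute.all _ _)

theorem embed_algebraMap (τ : K →+* ℂ) (x : K) : embed τ (algebraMap K (RealSpace K) x) = τ x := by
  rw [algebraMap_eq]
  exact (Algebra.TensorProduct.lift_tmul _ _ _ _ _).trans (by simp)

theorem eq_zero_of_embed (x : RealSpace K) (h : ∀ τ : K →+* ℂ, embed τ x = 0) : x = 0 := by
  let b : Module.Basis _ ℝ (RealSpace K) :=
    Algebra.TensorProduct.basis ℝ (NumberField.integralBasis K)
  have hb : ∀ (τ : K →+* ℂ) i,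
      embed τ (b i) = NumberField.canonicalEmbedding.latticeBasis K i τ := by
    intro τ i
    rw [NumberField.canonicalEmbedding.latticeBasis_apply]
    have h1 : b i = algebraMap K (RealSpace K) (NumberField.integralBasis K i) :=
      Algebra.TensorProduct.basis_apply _ _
    rw [h1, embed_algebraMap]
    rfl
  have h0 : ∑ i, ((b.repr x i : ℝ) : ℂ) • NumberField.canonicalEmbedding.latticeBasis K i = 0 := by
    funext τ
    have h1 := h τ
    rw [← b.sum_repr x, map_sum] at h1
    rw [Finset.sum_apply, Pi.zero_apply, ← h1]
    refine Finset.sum_congr rfl fun i _ => ?_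
    rw [map_smul, hb]
    simp
  have h2 := Fintype.linearIndependent_iff.mp
    (NumberField.canonicalEmbedding.latticeBasis K).linearIndependent _ h0
  rw [← b.sum_repr x]
  refine Finset.sum_eq_zero fun i _ => ?_
  have h3 : b.repr x i = 0 := by exact_mod_cast h2 i
  rw [h3, zero_smul]

/-- The scalar product `⟨x, y⟩ = tr(x ȳ) = ∑_τ τ(x) conj(τ(y))` on `K_ℝ`, where `τ` runs over the
embeddings of `K` in `ℂ`. (The sum is real; see also `inner_algebraMap`.) -/
instance innerCore : InnerProductSpace.Core ℝ (RealSpace K) where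
  inner x y := ∑ τ : K →+* ℂ, (embed τ x * conj (embed τ y)).re
  conj_inner_symm x y := by
    simp only [conj_trivial]
    refine Finset.sum_congr rfl fun τ _ => ?_
    simp only [Complex.mul_re, Complex.conj_re, Complex.conj_im]
    ring
  re_inner_nonneg x := by
    simp only [RCLike.re_to_real]
    refine Finset.sum_nonneg fun τ _ => ?_
    rw [Complex.mul_conj, Complex.ofReal_re]
    exact Complex.normSq_nonneg _
  add_left x y z := by
    rw [← Finset.sum_add_distrib]
    refine Finset.sum_congr rfl fun τ _ => ?_
    rw [map_add, add_mul, Complex.add_re]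
  smul_left x y r := by
    simp only [conj_trivial]
    rw [Finset.mul_sum]
    refine Finset.sum_congr rfl fun τ _ => ?_
    rw [map_smul, smul_mul_assoc, Complex.smul_re, smul_eq_mul]
  definite x hx := by
    refine eq_zero_of_embed x fun τ => ?_
    have h := (Finset.sum_eq_zero_iff_of_nonneg (fun τ _ => ?_)).mp hx τ (Finset.mem_univ τ)
    · rw [Complex.mul_conj, Complex.ofReal_re] at h
      exact Complex.normSq_eq_zero.mp h
    · rw [Complex.mul_conj, Complex.ofReal_re]
      exact Complex.normSq_nonneg _

instance : NormedAddCommGroup (RealSpace K) :=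
  InnerProductSpace.Core.toNormedAddCommGroup (𝕜 := ℝ) (cd := innerCore)

instance : InnerProductSpace ℝ (RealSpace K) := InnerProductSpace.ofCore _

theorem inner_def (x y : RealSpace K) :
    inner ℝ x y = ∑ τ : K →+* ℂ, (embed τ x * conj (embed τ y)).re := rfl

/-- On `K` the scalar product is the trace form `tr(x ȳ)`, as soon as `ȳ` makes sense in `K`. -/
theorem inner_algebraMap (x y z : K) (hz : ∀ τ : K →+* ℂ, τ z = conj (τ y)) :
    inner ℝ (algebraMap K (RealSpace K) x) (algebraMap K (RealSpace K) y) =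
      ((Algebra.trace ℚ K (x * z) : ℚ) : ℝ) := by
  have h := trace_eq_sum_embeddings (K := ℚ) (L := K) ℂ (x := x * z)
  have h2 : ((Algebra.trace ℚ K (x * z) : ℚ) : ℂ) = ∑ τ : K →+* ℂ, τ x * conj (τ y) := by
    rw [show ((Algebra.trace ℚ K (x * z) : ℚ) : ℂ) = algebraMap ℚ ℂ _ from
      (eq_ratCast (algebraMap ℚ ℂ) _).symm, h]
    refine (Fintype.sum_equiv (RingHom.equivRatAlgHom K ℂ) _ _ fun τ => ?_).symm
    rw [map_mul, ← hz]
    rfl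
  rw [inner_def]
  simp only [embed_algebraMap]
  rw [← Complex.re_sum, ← h2, Complex.ratCast_re]

instance : MeasurableSpace (RealSpace K) := borel _

instance : BorelSpace (RealSpace K) := ⟨rfl⟩

end RealSpace

/-! ## The lattices constructed from lines -/

section Construction

variable {K : Type*} [Field K] [NumberField K]

variable (K) in
/-- The image of `𝓞 K` in `K_ℝ`. -/
def integersLattice : Submodule (𝓞 K) (RealSpace K) :=
  LinearMap.range (Algebra.linearMap (𝓞 K) (RealSpace K))

/-- The lattice `𝔓⁻¹ 𝓞_K^#` of `K_ℝ`, where `𝓞_K^#` is the dual lattice of `𝓞_K`: the set of finite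
sums of products `a • z` with `a ∈ 𝔓⁻¹` and `z ∈ 𝓞_K^#`. -/
def invMulDual (P : Ideal (𝓞 K)) : Submodule (𝓞 K) (RealSpace K) :=
  Submodule.span (𝓞 K) {x | ∃ a ∈ (P : FractionalIdeal (nonZeroDivisors (𝓞 K)) K)⁻¹,
    ∃ z ∈ dualLattice ((integersLattice K).restrictScalars ℤ), x = a • z}

/-- `q = |𝓞_K / 𝔓|`. -/
def residueCard (P : Ideal (𝓞 K)) : ℕ := Nat.card (𝓞 K ⧸ P)

/-- `α = (q |d_K|)^(1 / (2 [K : ℚ]))`. -/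
def scalingFactor (P : Ideal (𝓞 K)) : ℝ :=
  ((residueCard P : ℝ) * |(NumberField.discr K : ℝ)|) ^ (1 / (2 * (Module.finrank ℚ K : ℝ)))

variable (K) in
/-- The Euclidean space `E = K_ℝ²`. -/
abbrev RealPlane : Type _ := WithLp 2 (RealSpace K × RealSpace K)

/-- `Λ₀ = α⁻¹ 𝓞_K × α 𝔓⁻¹ 𝓞_K^#`, as an `𝓞_K`-submodule of `E = K_ℝ²`. -/
def baseLattice (P : Ideal (𝓞 K)) : Submodule (𝓞 K) (RealPlane K) :=
  (((scalingFactor P)⁻¹ • integersLattice K).prod (scalingFactor P • invMulDual P)).comap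
    (WithLp.linearEquiv 2 (𝓞 K) (RealSpace K × RealSpace K)).toLinearMap

/-- `Λ₀ / 𝔓Λ₀`, a module over `F = 𝓞_K / 𝔓`. -/
abbrev CodeSpace (P : Ideal (𝓞 K)) : Type _ :=
  baseLattice P ⧸ (P • (⊤ : Submodule (𝓞 K) (baseLattice P)))

/-- The lattice `Λ_C = π⁻¹(C)`, where `π : Λ₀ → Λ₀ / 𝔓Λ₀` is the canonical surjection. -/
def codeLattice (P : Ideal (𝓞 K)) (C : Submodule (𝓞 K ⧸ P) (CodeSpace P)) :
    Submodule ℤ (RealPlane K) :=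
  AddSubgroup.toIntSubmodule
    ((C.toAddSubgroup.comap
      (P • (⊤ : Submodule (𝓞 K) (baseLattice P))).mkQ.toAddMonoidHom).map
        (baseLattice P).subtype.toAddMonoidHom)

/-- The family `𝓛_𝓒` of the lattices `Λ_C`, where `C` runs over the `F`-lines of `Λ₀ / 𝔓Λ₀`. -/
def lineLattices (P : Ideal (𝓞 K)) : Set (Submodule ℤ (RealPlane K)) :=
  {Λ | ∃ C : Submodule (𝓞 K ⧸ P) (CodeSpace P), Module.finrank (𝓞 K ⧸ P) C = 1 ∧
    Λ = codeLattice P C}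

theorem mem_codeLattice (P : Ideal (𝓞 K)) (C : Submodule (𝓞 K ⧸ P) (CodeSpace P))
    (x : RealPlane K) :
    x ∈ codeLattice P C ↔ ∃ h : x ∈ baseLattice P,
      (Submodule.Quotient.mk ⟨x, h⟩ : CodeSpace P) ∈ C := by
  constructor
  · rintro ⟨y, hy, rfl⟩
    exact ⟨y.2, hy⟩
  · rintro ⟨h, hx⟩
    exact ⟨⟨x, h⟩, hx, rfl⟩

end Construction

end

/-! Write n = φ(m), D for the codifferent and v ∧ w = v₁w₂ - v₂w₁. For m > 2 the field is CM: one
automorphism of K induces complex conjugation under every embedding. Hence ⟨x̄, y⟩ is the trace of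
xy, and the isometry σ(x, y) = (-ȳ, x̄), with σ² = -1, satisfies ⟨σv, w⟩ = tr(v ∧ w)
(`inner_symplecticRotation`).

Symplecticity. Up to the factors α⁻¹ and α, which cancel in v ∧ w, Λ₀ is O_K × P⁻¹D and PΛ₀ is P ×
D. So ∧ maps Λ₀ × Λ₀ to P⁻¹D and induces an alternating form on Λ₀/PΛ₀ with values in P⁻¹D/D. A line
is its own orthogonal for such a nondegenerate form in dimension two, which makes σ(Λ_C) the dual of
Λ_C (`isSymplecticLattice_codeLattice`). Consequently Λ_C has covolume 1
(`covolume_eq_one_of_isSymplecticLattice`).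

Density. A nonzero vector of PΛ₀ has squared norm at least n(q/|d_K|)^(1/n), by the
arithmetic-geometric mean inequality (`le_norm_scaledPoint_sq`). If r² is below this, a nonzero
vector of Λ₀ of norm at most r survives modulo PΛ₀, so it lies in at most one Λ_C. Suppose that
every Λ_C contained such a vector. Multiplication by the m-th roots of unity preserves norms and
each Λ_C, so Λ₀ would have at least m vectors in the ball of radius r for each line. The number of
lines times the covolume of Λ₀ is at least 1. If every point of E is within ρ of Λ₀, counting by
fundamental domains (`card_mul_covolume_le`) then gives m ≤ Vol B(r + ρ). So some Λ_C has no nonzero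
vector in the ball once Vol B(r + ρ) < m (`exists_lineLattice_forall_lt_norm`).

It remains to choose r with Vol B(r) = (1 - ε/2)m. Minkowski's theorem and rounding allow ρ² of
order n²/q^(1/n) (`exists_norm_sub_baseZLattice_le`), and the growth hypothesis makes ρ so small
compared with r/n that Vol B(r + ρ) stays below m (`exists_radius`). -/

noncomputable section

/-! ### Conjugation and the trace form on K_ℝ -/

namespace RealSpace

variable {K : Type*} [Field K] [NumberField K]

/-- A `ℚ`-basis of `K`, seen as an `ℝ`-basis of `K_ℝ`. -/
def realBasis {ι : Type*} (b : Module.Basis ι ℚ K) : Module.Basis ι ℝ (RealSpace K) :=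
  Algebra.TensorProduct.basis ℝ b

theorem realBasis_apply {ι : Type*} (b : Module.Basis ι ℚ K) (i : ι) :
    realBasis b i = algebraMap K (RealSpace K) (b i) :=
  Algebra.TensorProduct.basis_apply _ _

theorem finrank_eq : Module.finrank ℝ (RealSpace K) = Module.finrank ℚ K := by
  rw [Module.finrank_eq_card_basis (realBasis (Module.finBasis ℚ K)), Fintype.card_fin]

theorem embed_smul (τ : K →+* ℂ) (a : K) (x : RealSpace K) :
    embed τ (a • x) = τ a * embed τ x := by
  rw [Algebra.smul_def, map_mul, embed_algebraMap]

theorem norm_sq (x : RealSpace K) : ‖x‖ ^ 2 = ∑ τ : K →+* ℂ, ‖embed τ x‖ ^ 2 := by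
  rw [← real_inner_self_eq_norm_sq, inner_def]
  refine Finset.sum_congr rfl fun τ _ => ?_
  rw [Complex.mul_conj, Complex.ofReal_re, Complex.normSq_eq_norm_sq]

theorem ext_embed {x y : RealSpace K} (h : ∀ τ : K →+* ℂ, embed τ x = embed τ y) : x = y :=
  sub_eq_zero.mp (eq_zero_of_embed _ fun τ => by rw [map_sub, h, sub_self])

/-- The `ℝ`-linear extension of the trace of `K` to `K_ℝ`. -/
def realTrace : RealSpace K →ₗ[ℝ] ℝ :=
  ∑ τ : K →+* ℂ, Complex.reLm ∘ₗ (embed τ).toLinearMap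

theorem realTrace_apply (x : RealSpace K) : realTrace x = ∑ τ : K →+* ℂ, (embed τ x).re := by
  simp [realTrace]

theorem realTrace_algebraMap (a : K) :
    realTrace (algebraMap K (RealSpace K) a) = ((Algebra.trace ℚ K a : ℚ) : ℝ) := by
  have h := inner_algebraMap a 1 1 (fun τ => by simp)
  rw [mul_one] at h
  rw [← h, realTrace_apply, inner_def]
  simp

section Conj

variable (c : K →+* K)

/-- The `ℝ`-linear extension to `K_ℝ` of an endomorphism of `K`. -/
def extend : RealSpace K →ₐ[ℝ] RealSpace K :=
  (Algebra.TensorProduct.map (AlgHom.id ℝ ℝ) c.toRatAlgHom : ℝ ⊗[ℚ] K →ₐ[ℝ] ℝ ⊗[ℚ] K)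

theorem extend_algebraMap (a : K) :
    extend c (algebraMap K (RealSpace K) a) = algebraMap K (RealSpace K) (c a) :=
  Algebra.TensorProduct.map_tmul _ _ _ _

variable {c} (hc : ∀ (τ : K →+* ℂ) (a : K), τ (c a) = conj (τ a))
include hc

theorem embed_extend (τ : K →+* ℂ) (x : RealSpace K) :
    embed τ (extend c x) = conj (embed τ x) := by
  let b := realBasis (Module.finBasis ℚ K)
  have h : (embed τ).toLinearMap ∘ₗ (extend c).toLinearMap =
      Complex.conjAe.toLinearMap ∘ₗ (embed τ).toLinearMap := by
    refine b.ext fun i => ?_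
    simp [b, realBasis_apply, extend_algebraMap, embed_algebraMap, hc]
  exact LinearMap.congr_fun h x

theorem extend_extend (x : RealSpace K) : extend c (extend c x) = x :=
  ext_embed fun τ => by rw [embed_extend hc, embed_extend hc, Complex.conj_conj]

/-- Complex conjugation on `K_ℝ`. -/
def conjIso : RealSpace K ≃ₗᵢ[ℝ] RealSpace K where
  toLinearEquiv := LinearEquiv.ofInvolutive (extend c).toLinearMap (extend_extend hc)
  norm_map' x := by
    have h : ‖extend c x‖ ^ 2 = ‖x‖ ^ 2 := by
      rw [norm_sq, norm_sq]
      refine Finset.sum_congr rfl fun τ _ => ?_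
      rw [embed_extend hc, Complex.norm_conj]
    exact (sq_eq_sq₀ (norm_nonneg _) (norm_nonneg _)).mp h

theorem conjIso_conjIso (x : RealSpace K) : conjIso hc (conjIso hc x) = x :=
  extend_extend hc x

theorem conjIso_algebraMap (a : K) :
    conjIso hc (algebraMap K (RealSpace K) a) = algebraMap K (RealSpace K) (c a) :=
  extend_algebraMap c a

theorem inner_conjIso (x y : RealSpace K) : inner ℝ (conjIso hc x) y = realTrace (x * y) := by
  rw [← (conjIso hc).inner_map_map, conjIso_conjIso, inner_def, realTrace_apply]
  refine Finset.sum_congr rfl fun τ _ => ?_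
  rw [map_mul, show embed τ (conjIso hc y) = conj (embed τ y) from embed_extend hc τ y,
    Complex.conj_conj]

end Conj

end RealSpace

/-! ### Trace duality of fractional ideals inside K_ℝ -/

section Duality

open FractionalIdeal nonZeroDivisors

namespace RealSpace

variable {K : Type*} [Field K] [NumberField K]

theorem exists_realTrace_eq_intCast {I : FractionalIdeal (𝓞 K)⁰ K} (hI : I ≠ 0) {a b : K}
    (ha : a ∈ I) (hb : b ∈ dual ℤ ℚ I) :
    ∃ k : ℤ, realTrace (algebraMap K (RealSpace K) (b * a)) = k := by
  obtain ⟨k, hk⟩ := (mem_dual hI).mp hb a ha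
  refine ⟨k, ?_⟩
  rw [realTrace_algebraMap, ← Algebra.traceForm_apply, ← hk]
  simp

variable {c : K →+* K}
  (hc : ∀ (τ : K →+* ℂ) (a : K), τ (c a) = conj (τ a))
include hc

/-- The trace form is nondegenerate on K_ℝ because the trace of x·x̄ is the squared norm of x. -/
theorem eq_zero_of_realTrace_mul_basis {ι : Type*} (b : Module.Basis ι ℚ K) {x : RealSpace K}
    (h : ∀ i, realTrace (x * algebraMap K (RealSpace K) (b i)) = 0) : x = 0 := by
  have h1 : realTrace ∘ₗ LinearMap.mulLeft ℝ x = 0 := by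
    refine (realBasis b).ext fun i => ?_
    simpa [realBasis_apply] using h i
  have h2 : inner ℝ (conjIso hc x) (conjIso hc x) = 0 := by
    rw [inner_conjIso]
    exact LinearMap.congr_fun h1 _
  simpa using inner_self_eq_zero.mp h2

/-- A real point with integral traces against I already lies in K: the integers obtained on a
ℤ-basis of I are its coordinates in the trace-dual basis, and nondegeneracy leaves no other point.
-/
theorem exists_mem_dual_of_realTrace_mul {I : FractionalIdeal (𝓞 K)⁰ K} (hI : I ≠ 0)
    {x : RealSpace K}
    (h : ∀ a ∈ I, ∃ k : ℤ, realTrace (x * algebraMap K (RealSpace K) a) = k) :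
    ∃ b ∈ dual ℤ ℚ I, x = algebraMap K (RealSpace K) b := by
  classical
  obtain ⟨ι, _, b, hb⟩ : ∃ (ι : Type _) (_ : Fintype ι) (b : Module.Basis ι ℚ K),
      ∀ a, a ∈ I ↔ a ∈ Submodule.span ℤ (Set.range b) :=
    ⟨_, inferInstance, NumberField.basisOfFractionalIdeal K (Units.mk0 I hI), fun a =>
      (NumberField.mem_span_basisOfFractionalIdeal K (I := Units.mk0 I hI) (x := a)).symm⟩
  have hbI : ∀ i, b i ∈ I := fun i => (hb _).mpr (Submodule.subset_span ⟨i, rfl⟩)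
  choose k hk using fun i => h (b i) (hbI i)
  let y : K := ∑ i, (k i : ℚ) • b.traceDual i
  have hy : ∀ j, Algebra.trace ℚ K (y * b j) = k j := by
    intro j
    simp only [y, Finset.sum_mul, map_sum, smul_mul_assoc, map_smul]
    simp [Module.Basis.trace_traceDual_mul]
  refine ⟨y, ?_, ?_⟩
  · rw [mem_dual hI]
    intro a ha
    rw [hb] at ha
    rw [Algebra.traceForm_apply]
    induction ha using Submodule.span_induction with
    | mem a ha =>
      obtain ⟨j, rfl⟩ := ha
      exact ⟨k j, by simp [hy]⟩
    | zero => simp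
    | add a a' _ _ h h' => rw [mul_add, map_add]; exact add_mem h h'
    | smul n a _ h =>
      rw [mul_smul_comm, map_zsmul]
      exact zsmul_mem h n
  · rw [← sub_eq_zero]
    refine eq_zero_of_realTrace_mul_basis hc b fun i => ?_
    rw [sub_mul, map_sub, hk, ← map_mul, realTrace_algebraMap, hy]
    simp

/-- The scalar product and the trace form differ by a conjugation, under which 𝓞 K is stable, so the
metric dual is the codifferent. -/
theorem mem_dualLattice_integersLattice (x : RealSpace K) :
    x ∈ dualLattice ((integersLattice K).restrictScalars ℤ) ↔
      ∃ b ∈ dual ℤ ℚ (1 : FractionalIdeal (𝓞 K)⁰ K), x = algebraMap K (RealSpace K) b := by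
  have hO : ∀ a : K, a ∈ (1 : FractionalIdeal (𝓞 K)⁰ K) → c a ∈ (1 : FractionalIdeal (𝓞 K)⁰ K) := by
    intro a ha
    obtain ⟨a, rfl⟩ := mem_one_iff _ |>.mp ha
    exact (mem_one_iff _).mpr ⟨⟨c a, map_isIntegral_int c a.2⟩, rfl⟩
  have hinner : ∀ y a, inner ℝ y (algebraMap K (RealSpace K) a) =
      realTrace (y * algebraMap K (RealSpace K) (c a)) := by
    intro y a
    rw [← (conjIso hc).inner_map_map, conjIso_algebraMap, inner_conjIso]
  have hcc : ∀ a, c (c a) = a := by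
    intro a
    obtain ⟨τ⟩ : Nonempty (K →+* ℂ) := inferInstance
    apply τ.injective
    rw [hc, hc, Complex.conj_conj]
  constructor
  · intro hx
    refine exists_mem_dual_of_realTrace_mul hc
      (one_ne_zero : (1 : FractionalIdeal (𝓞 K)⁰ K) ≠ 0) fun a ha => ?_
    obtain ⟨a', ha'⟩ := (mem_one_iff _).mp (hO a ha)
    obtain ⟨k, hk⟩ := hx (algebraMap K (RealSpace K) (c a)) ⟨a', by rw [← ha']; rfl⟩
    exact ⟨k, by rw [← hk, hinner, hcc]⟩
  · rintro ⟨b, hb, rfl⟩ y ⟨a, rfl⟩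
    obtain ⟨k, hk⟩ := exists_realTrace_eq_intCast
      (one_ne_zero : (1 : FractionalIdeal (𝓞 K)⁰ K) ≠ 0)
      (hO _ ((mem_one_iff _).mpr ⟨a, rfl⟩)) hb
    exact ⟨k, by rw [← hk, map_mul, ← hinner]; rfl⟩

theorem mem_invMulDual (P : Ideal (𝓞 K)) (x : RealSpace K) :
    x ∈ invMulDual P ↔ ∃ b ∈ (P : FractionalIdeal (𝓞 K)⁰ K)⁻¹ * dual ℤ ℚ 1,
      x = algebraMap K (RealSpace K) b := by
  constructor
  · intro hx
    induction hx using Submodule.span_induction with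
    | mem x hx =>
      obtain ⟨a, ha, z, hz, rfl⟩ := hx
      obtain ⟨b, hb, rfl⟩ := (mem_dualLattice_integersLattice hc z).mp hz
      exact ⟨a * b, mul_mem_mul ha hb, by rw [map_mul, Algebra.smul_def]⟩
    | zero => exact ⟨0, zero_mem _, by simp⟩
    | add x y _ _ hx hy =>
      obtain ⟨a, ha, rfl⟩ := hx
      obtain ⟨b, hb, rfl⟩ := hy
      exact ⟨a + b, Submodule.add_mem _ ha hb, by simp⟩
    | smul r x _ hx =>
      obtain ⟨a, ha, rfl⟩ := hx
      exact ⟨r • a, Submodule.smul_mem _ r ha, by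
        rw [Algebra.algebraMap_eq_smul_one, Algebra.algebraMap_eq_smul_one, smul_assoc]⟩
  · rintro ⟨b, hb, rfl⟩
    refine FractionalIdeal.mul_induction_on hb (fun a ha b hb => ?_) fun x y hx hy => ?_
    · refine Submodule.subset_span ⟨a, ha, _,
        (mem_dualLattice_integersLattice hc _).mpr ⟨b, hb, rfl⟩, ?_⟩
      rw [map_mul, Algebra.smul_def]
    · rw [map_add]
      exact add_mem hx hy

end RealSpace

end Duality

/-! ### The symplectic rotation and coordinates on Λ₀ and PΛ₀ -/

section Symplectic

open FractionalIdeal nonZeroDivisors RealSpace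

/-- Integers of absolute value below 1 vanish, so the open condition |⟨x, tᵢ⟩| < 1 on a basis taken
from M isolates 0 in Λ. -/
theorem discreteTopology_of_inner_int {E : Type*} [NormedAddCommGroup E] [InnerProductSpace ℝ E]
    [FiniteDimensional ℝ E] {Λ : Submodule ℤ E} {M : Set E} (hM : Submodule.span ℝ M = ⊤)
    (h : ∀ x ∈ Λ, ∀ y ∈ M, ∃ k : ℤ, inner ℝ x y = k) : DiscreteTopology Λ := by
  obtain ⟨t, htM, htspan, htli⟩ := exists_linearIndependent ℝ M
  have htop : ⊤ ≤ Submodule.span ℝ (Set.range ((↑) : t → E)) := by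
    rw [Subtype.range_coe, htspan, hM]
  let b : Module.Basis t ℝ E := Module.Basis.mk htli htop
  have : Finite t := Module.Finite.finite_basis b
  refine discreteTopology_of_isOpen_singleton_zero ?_
  have hopen : IsOpen {x : Λ | ∀ i : t, |inner ℝ (x : E) (i : E)| < 1} := by
    simp only [Set.ofPred_forall]
    exact isOpen_iInter_of_finite fun i => isOpen_lt (by fun_prop) continuous_const
  convert! hopen using 1
  ext x
  simp only [Set.mem_singleton_iff, Set.mem_ofPred_eq]
  constructor
  · rintro rfl i
    simp
  · intro hx
    have h0 : ∀ i : t, inner ℝ (x : E) (i : E) = 0 := by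
      intro i
      obtain ⟨k, hk⟩ := h x x.2 i (htM i.2)
      have h1 := hx i
      rw [hk] at h1 ⊢
      have h2 : |k| < 1 := by exact_mod_cast h1
      rw [Int.abs_lt_one_iff.mp h2, Int.cast_zero]
    have h1 : innerₗ E (x : E) = 0 := b.ext fun i => by simp [b, h0]
    exact Subtype.ext (inner_self_eq_zero.mp (LinearMap.congr_fun h1 (x : E)))

variable {K : Type*} [Field K] [NumberField K]

variable (K) in
/-- The codifferent of `K`: the dual of `𝓞 K` for the trace form. -/
abbrev codifferent : FractionalIdeal (𝓞 K)⁰ K := dual ℤ ℚ 1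

theorem codifferent_ne_zero : codifferent K ≠ 0 := dual_ne_zero ℤ ℚ one_ne_zero

theorem span_fractionalIdeal {I : FractionalIdeal (𝓞 K)⁰ K} (hI : I ≠ 0) :
    Submodule.span ℝ (algebraMap K (RealSpace K) '' (I : Set K)) = ⊤ := by
  let b := NumberField.basisOfFractionalIdeal K (Units.mk0 I hI)
  rw [eq_top_iff, ← (realBasis b).span_eq]
  refine Submodule.span_mono ?_
  rintro _ ⟨i, rfl⟩
  rw [realBasis_apply]
  refine ⟨b i, ?_, rfl⟩
  exact (NumberField.mem_span_basisOfFractionalIdeal K (I := Units.mk0 I hI)).mp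
    (Submodule.subset_span ⟨i, rfl⟩)

/-- The point `(α⁻¹ a, α b)` of `E`. -/
def scaledPoint (P : Ideal (𝓞 K)) (a b : K) : RealPlane K :=
  WithLp.toLp 2 ((scalingFactor P)⁻¹ • algebraMap K (RealSpace K) a,
    scalingFactor P • algebraMap K (RealSpace K) b)

theorem scaledPoint_add (P : Ideal (𝓞 K)) (a b a' b' : K) :
    scaledPoint P a b + scaledPoint P a' b' = scaledPoint P (a + a') (b + b') := by
  simp [scaledPoint, ← WithLp.toLp_add]

theorem scaledPoint_zero (P : Ideal (𝓞 K)) : scaledPoint P 0 0 = 0 := by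
  simp [scaledPoint]

theorem smul_scaledPoint (P : Ideal (𝓞 K)) (r : 𝓞 K) (a b : K) :
    r • scaledPoint P a b = scaledPoint P (r * a) (r * b) := by
  have h : ∀ (s : ℝ) (a : K), r • s • algebraMap K (RealSpace K) a =
      s • algebraMap K (RealSpace K) (r * a) := by
    intro s a
    rw [smul_comm, map_mul, ← Algebra.smul_def]
    rfl
  rw [scaledPoint, ← WithLp.toLp_smul, Prod.smul_mk, h, h]
  rfl

theorem finite_quotient {P : Ideal (𝓞 K)} (hP : P ≠ ⊥) : Finite (𝓞 K ⧸ P) :=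
  Ideal.finiteQuotientOfFreeOfNeBot P hP

theorem residueCard_pos {P : Ideal (𝓞 K)} (hP : P ≠ ⊥) : 0 < residueCard P :=
  have := finite_quotient hP
  Nat.card_pos

theorem one_le_abs_discr : (1 : ℝ) ≤ |(NumberField.discr K : ℝ)| := by
  exact_mod_cast Int.one_le_abs (NumberField.discr_ne_zero K)

theorem scalingFactor_pos {P : Ideal (𝓞 K)} (hP : P ≠ ⊥) : 0 < scalingFactor P := by
  have h1 : (0 : ℝ) < residueCard P := by exact_mod_cast residueCard_pos hP
  have h2 := one_le_abs_discr (K := K)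
  unfold scalingFactor
  positivity

theorem scaledPoint_injective {P : Ideal (𝓞 K)} (hP : P ≠ ⊥) {a b a' b' : K}
    (h : scaledPoint P a b = scaledPoint P a' b') : a = a' ∧ b = b' := by
  have hα := (scalingFactor_pos hP).ne'
  have hinj : Function.Injective (algebraMap K (RealSpace K)) := by
    intro x y hxy
    obtain ⟨τ⟩ : Nonempty (K →+* ℂ) := inferInstance
    apply τ.injective
    rw [← embed_algebraMap, ← embed_algebraMap, hxy]
  have h1 := congrArg WithLp.ofLp h
  simp only [scaledPoint, Prod.mk.injEq] at h1
  exact ⟨hinj (smul_right_injective _ (inv_ne_zero hα) h1.1),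
    hinj (smul_right_injective _ hα h1.2)⟩

variable {c : K →+* K} (hc : ∀ (τ : K →+* ℂ) (a : K), τ (c a) = conj (τ a))

/-- The isometry `(x, y) ↦ (-ȳ, x̄)` of `E`. -/
def symplecticRotation : RealPlane K ≃ₗᵢ[ℝ] RealPlane K where
  toFun x := WithLp.toLp 2 (-conjIso hc x.snd, conjIso hc x.fst)
  invFun x := WithLp.toLp 2 (conjIso hc x.snd, -conjIso hc x.fst)
  map_add' x y := by
    refine WithLp.ofLp_injective 2 (Prod.ext ?_ ?_) <;> simp [add_comm]
  map_smul' r x := by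
    refine WithLp.ofLp_injective 2 (Prod.ext ?_ ?_) <;> simp
  left_inv x := by
    simp only [WithLp.toLp_fst, WithLp.toLp_snd, map_neg, neg_neg, conjIso_conjIso]
    rfl
  right_inv x := by
    simp only [WithLp.toLp_fst, WithLp.toLp_snd, map_neg, neg_neg, conjIso_conjIso]
    rfl
  norm_map' x := by
    rw [← sq_eq_sq₀ (norm_nonneg _) (norm_nonneg _), WithLp.prod_norm_sq_eq_of_L2,
      WithLp.prod_norm_sq_eq_of_L2]
    simp [add_comm]

theorem symplecticRotation_apply (x : RealPlane K) :
    symplecticRotation hc x = WithLp.toLp 2 (-conjIso hc x.snd, conjIso hc x.fst) := rfl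

theorem symplecticRotation_symplecticRotation (x : RealPlane K) :
    symplecticRotation hc (symplecticRotation hc x) = -x := by
  refine WithLp.ofLp_injective 2 (Prod.ext ?_ ?_) <;>
    simp [symplecticRotation_apply, conjIso_conjIso]

theorem inner_symplecticRotation (x y : RealPlane K) :
    inner ℝ (symplecticRotation hc x) y = realTrace (x.fst * y.snd - x.snd * y.fst) := by
  rw [WithLp.prod_inner_apply, symplecticRotation_apply, map_sub, ← inner_conjIso hc, ← inner_conjIso hc]
  simp only [inner_neg_left]
  rw [neg_add_eq_sub]
  rfl

theorem inner_symplecticRotation_scaledPoint {P : Ideal (𝓞 K)} (hP : P ≠ ⊥) (a b a' b' : K) :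
    inner ℝ (symplecticRotation hc (scaledPoint P a b)) (scaledPoint P a' b') =
      realTrace (algebraMap K (RealSpace K) (a * b' - b * a')) := by
  have hα := (scalingFactor_pos hP).ne'
  rw [inner_symplecticRotation]
  simp [scaledPoint, smul_smul, hα]

include hc in
theorem mem_baseLattice (P : Ideal (𝓞 K)) (x : RealPlane K) :
    x ∈ baseLattice P ↔ ∃ a ∈ (1 : FractionalIdeal (𝓞 K)⁰ K),
      ∃ b ∈ (P : FractionalIdeal (𝓞 K)⁰ K)⁻¹ * codifferent K, x = scaledPoint P a b := by
  rw [baseLattice, Submodule.mem_comap, Submodule.mem_prod]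
  constructor
  · rintro ⟨⟨y, ⟨a, rfl⟩, hy⟩, ⟨z, hz, hz'⟩⟩
    obtain ⟨b, hb, rfl⟩ := (mem_invMulDual hc P z).mp hz
    exact ⟨a, (mem_one_iff _).mpr ⟨a, rfl⟩, b, hb, WithLp.ofLp_injective 2 (Prod.ext hy.symm hz'.symm)⟩
  · rintro ⟨a, ha, b, hb, rfl⟩
    obtain ⟨a, rfl⟩ := (mem_one_iff _).mp ha
    exact ⟨⟨_, ⟨a, rfl⟩, rfl⟩, ⟨_, (mem_invMulDual hc P _).mpr ⟨b, hb, rfl⟩, rfl⟩⟩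

-- The second coordinate works because P · P⁻¹D = D.
include hc in
theorem mem_smul_baseLattice {P : Ideal (𝓞 K)} (hP : P ≠ ⊥) (x : baseLattice P) :
    x ∈ P • (⊤ : Submodule (𝓞 K) (baseLattice P)) ↔ ∃ a ∈ (P : FractionalIdeal (𝓞 K)⁰ K),
      ∃ b ∈ codifferent K, (x : RealPlane K) = scaledPoint P a b := by
  have hP' : (P : FractionalIdeal (𝓞 K)⁰ K) ≠ 0 := coeIdeal_ne_zero.mpr hP
  have hPD : (P : FractionalIdeal (𝓞 K)⁰ K) * ((P : FractionalIdeal (𝓞 K)⁰ K)⁻¹ * codifferent K) =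
      codifferent K := mul_inv_cancel_left₀ hP' _
  constructor
  · intro hx
    induction hx using Submodule.smul_induction_on' with
    | smul r hr y _ =>
      obtain ⟨a, ha, b, hb, hy⟩ := (mem_baseLattice hc P y).mp y.2
      have hr' : (r : K) ∈ (P : FractionalIdeal (𝓞 K)⁰ K) := mem_coeIdeal_of_mem _ hr
      refine ⟨r * a, ?_, r * b, ?_, ?_⟩
      · rw [← mul_one (P : FractionalIdeal (𝓞 K)⁰ K)]
        exact mul_mem_mul hr' ha
      · rw [← hPD]
        exact mul_mem_mul hr' hb
      · rw [← smul_scaledPoint, ← hy]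
        rfl
    | add y _ z _ hy hz =>
      obtain ⟨a, ha, b, hb, hy⟩ := hy
      obtain ⟨a', ha', b', hb', hz⟩ := hz
      refine ⟨a + a', Submodule.add_mem _ ha ha', b + b', Submodule.add_mem _ hb hb', ?_⟩
      rw [← scaledPoint_add, ← hy, ← hz]
      rfl
  · rintro ⟨a, ha, b, hb, hx⟩
    have h1 : ∀ a ∈ (P : FractionalIdeal (𝓞 K)⁰ K),
        ∃ z ∈ P • (⊤ : Submodule (𝓞 K) (baseLattice P)),
          (z : RealPlane K) = scaledPoint P a 0 := by
      intro a ha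
      obtain ⟨r, hr, rfl⟩ := (mem_coeIdeal _).mp ha
      have h10 : scaledPoint P 1 0 ∈ baseLattice P :=
        (mem_baseLattice hc P _).mpr ⟨1, one_mem_one _, 0, zero_mem _, rfl⟩
      refine ⟨r • ⟨_, h10⟩, Submodule.smul_mem_smul hr Submodule.mem_top, ?_⟩
      change r • scaledPoint P 1 0 = _
      rw [smul_scaledPoint, mul_one, mul_zero]
    have h2 : ∀ b ∈ codifferent K, ∃ z ∈ P • (⊤ : Submodule (𝓞 K) (baseLattice P)),
          (z : RealPlane K) = scaledPoint P 0 b := by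
      intro b hb
      rw [← hPD] at hb
      refine FractionalIdeal.mul_induction_on hb (fun r hrP b hb => ?_) fun x y hx hy => ?_
      · obtain ⟨r, hr, rfl⟩ := (mem_coeIdeal _).mp hrP
        have h10 : scaledPoint P 0 b ∈ baseLattice P :=
          (mem_baseLattice hc P _).mpr ⟨0, zero_mem _, b, hb, rfl⟩
        refine ⟨r • ⟨_, h10⟩, Submodule.smul_mem_smul hr Submodule.mem_top, ?_⟩
        change r • scaledPoint P 0 b = _
        rw [smul_scaledPoint, mul_zero]
      · obtain ⟨x', hx, hx'⟩ := hx
        obtain ⟨y', hy, hy'⟩ := hy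
        refine ⟨x' + y', add_mem hx hy, ?_⟩
        rw [Submodule.coe_add, hx', hy', scaledPoint_add, add_zero]
    obtain ⟨y, hy, hy'⟩ := h1 a ha
    obtain ⟨z, hz, hz'⟩ := h2 b hb
    have hxyz : x = y + z := by
      refine Subtype.ext ?_
      rw [Submodule.coe_add, hx, hy', hz', scaledPoint_add, add_zero, zero_add]
    rw [hxyz]
    exact add_mem hy hz

end Symplectic

/-! ### The lattices Λ_C are symplectic -/

section CodeLattice

open FractionalIdeal nonZeroDivisors RealSpace

variable {K : Type*} [Field K] [NumberField K]

theorem det_mem_codifferent {P : Ideal (𝓞 K)} (hP : P ≠ ⊥) {a b a' b' : K}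
    (ha : a ∈ (1 : FractionalIdeal (𝓞 K)⁰ K))
    (hb : b ∈ (P : FractionalIdeal (𝓞 K)⁰ K)⁻¹ * codifferent K)
    (ha' : a' ∈ (P : FractionalIdeal (𝓞 K)⁰ K)) (hb' : b' ∈ codifferent K) :
    a * b' - b * a' ∈ codifferent K := by
  have hP' : (P : FractionalIdeal (𝓞 K)⁰ K) ≠ 0 := coeIdeal_ne_zero.mpr hP
  refine Submodule.sub_mem _ ?_ ?_
  · rw [← one_mul (codifferent K)]
    exact mul_mem_mul ha hb'
  · rw [← mul_inv_cancel_left₀ hP' (codifferent K), mul_comm b]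
    exact mul_mem_mul ha' hb

theorem exists_generator {P : Ideal (𝓞 K)} (hP : P ≠ ⊥) (hPp : P.IsPrime)
    {C : Submodule (𝓞 K ⧸ P) (CodeSpace P)} (hC : Module.finrank (𝓞 K ⧸ P) C = 1) :
    ∃ v : baseLattice P, v ∉ P • (⊤ : Submodule (𝓞 K) (baseLattice P)) ∧
      ∀ w : baseLattice P, (Submodule.Quotient.mk w : CodeSpace P) ∈ C ↔
        ∃ r : 𝓞 K, w - r • v ∈ P • (⊤ : Submodule (𝓞 K) (baseLattice P)) := by
  have := hPp.isMaximal hP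
  let _ : Field (𝓞 K ⧸ P) := Ideal.Quotient.field P
  obtain ⟨⟨v, hvC⟩, hv0, hv⟩ := finrank_eq_one_iff'.mp hC
  obtain ⟨v, rfl⟩ := Submodule.Quotient.mk_surjective _ v
  refine ⟨v, fun h => hv0 ?_, fun w => ⟨fun h => ?_, ?_⟩⟩
  · exact Subtype.ext ((Submodule.Quotient.mk_eq_zero _).mpr h)
  · obtain ⟨r, hr⟩ := hv ⟨_, h⟩
    obtain ⟨r, rfl⟩ := Ideal.Quotient.mk_surjective r
    refine ⟨r, ?_⟩
    rw [← Submodule.Quotient.mk_eq_zero, Submodule.Quotient.mk_sub, sub_eq_zero]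
    exact (congrArg Subtype.val hr).symm
  · rintro ⟨r, hr⟩
    rw [← Submodule.Quotient.mk_eq_zero, Submodule.Quotient.mk_sub, sub_eq_zero] at hr
    rw [hr]
    exact C.smul_mem (Ideal.Quotient.mk P r) hvC

variable {c : K →+* K} (hc : ∀ (τ : K →+* ℂ) (a : K), τ (c a) = conj (τ a))
include hc

theorem exists_generator_coords {P : Ideal (𝓞 K)} (hP : P ≠ ⊥) (hPp : P.IsPrime)
    {C : Submodule (𝓞 K ⧸ P) (CodeSpace P)} (hC : Module.finrank (𝓞 K ⧸ P) C = 1) :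
    ∃ a₀ ∈ (1 : FractionalIdeal (𝓞 K)⁰ K),
      ∃ b₀ ∈ (P : FractionalIdeal (𝓞 K)⁰ K)⁻¹ * codifferent K,
        ¬ (a₀ ∈ (P : FractionalIdeal (𝓞 K)⁰ K) ∧ b₀ ∈ codifferent K) ∧
        ∀ a ∈ (1 : FractionalIdeal (𝓞 K)⁰ K),
          ∀ b ∈ (P : FractionalIdeal (𝓞 K)⁰ K)⁻¹ * codifferent K,
            scaledPoint P a b ∈ codeLattice P C ↔
              ∃ r : 𝓞 K, a - r * a₀ ∈ (P : FractionalIdeal (𝓞 K)⁰ K) ∧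
                b - r * b₀ ∈ codifferent K := by
  obtain ⟨v, hv, hC⟩ := exists_generator hP hPp hC
  obtain ⟨a₀, ha₀, b₀, hb₀, hv'⟩ := (mem_baseLattice hc P v).mp v.2
  refine ⟨a₀, ha₀, b₀, hb₀, fun h => hv ?_, fun a ha b hb => ?_⟩
  · exact (mem_smul_baseLattice hc hP v).mpr ⟨a₀, h.1, b₀, h.2, hv'⟩
  · have hbase : scaledPoint P a b ∈ baseLattice P :=
      (mem_baseLattice hc P _).mpr ⟨a, ha, b, hb, rfl⟩
    rw [mem_codeLattice]
    have hsub : ∀ r : 𝓞 K, ((⟨_, hbase⟩ - r • v : baseLattice P) : RealPlane K) =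
        scaledPoint P (a - r * a₀) (b - r * b₀) := by
      intro r
      rw [Submodule.coe_sub, Submodule.coe_smul, hv', smul_scaledPoint, sub_eq_iff_eq_add,
        scaledPoint_add, sub_add_cancel, sub_add_cancel]
    constructor
    · rintro ⟨_, h⟩
      obtain ⟨r, hr⟩ := (hC _).mp h
      obtain ⟨a', ha', b', hb', h'⟩ := (mem_smul_baseLattice hc hP _).mp hr
      rw [hsub] at h'
      obtain ⟨h1, h2⟩ := scaledPoint_injective hP h'
      exact ⟨r, h1 ▸ ha', h2 ▸ hb'⟩
    · rintro ⟨r, h1, h2⟩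
      exact ⟨hbase, (hC _).mpr ⟨r, (mem_smul_baseLattice hc hP _).mpr ⟨_, h1, _, h2, hsub r⟩⟩⟩

-- The quotient P⁻¹D/D is a line over F, and t plays the role of an inverse of the nonzero class of
-- δ. The fractional ideal δ · PD⁻¹ is integral and not contained in P, so it has an element
-- invertible modulo P; a multiple of it is congruent to 1.
omit hc in
theorem exists_mul_sub_one_mem {P : Ideal (𝓞 K)} (hP : P ≠ ⊥) (hPp : P.IsPrime) {δ : K}
    (hδ : δ ∈ (P : FractionalIdeal (𝓞 K)⁰ K)⁻¹ * codifferent K) (hδ' : δ ∉ codifferent K) :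
    ∃ t ∈ (P : FractionalIdeal (𝓞 K)⁰ K) * (codifferent K)⁻¹,
      1 - t * δ ∈ (P : FractionalIdeal (𝓞 K)⁰ K) := by
  have hPmax := hPp.isMaximal hP
  have hP' : (P : FractionalIdeal (𝓞 K)⁰ K) ≠ 0 := coeIdeal_ne_zero.mpr hP
  set I : FractionalIdeal (𝓞 K)⁰ K := (P : FractionalIdeal (𝓞 K)⁰ K) * (codifferent K)⁻¹ with hI
  have hI0 : I⁻¹ = (P : FractionalIdeal (𝓞 K)⁰ K)⁻¹ * codifferent K := by
    rw [hI, mul_inv, inv_inv]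
  have hIne : I ≠ 0 := mul_ne_zero hP' (inv_ne_zero codifferent_ne_zero)
  have hle : spanSingleton (𝓞 K)⁰ δ * I ≤ 1 := by
    rw [← inv_mul_cancel₀ hIne]
    exact mul_le_mul_left (spanSingleton_le_iff_mem.mpr (hI0 ▸ hδ)) I
  obtain ⟨J, hJ⟩ := le_one_iff_exists_coeIdeal.mp hle
  have hJP : ¬ J ≤ P := by
    intro h
    refine hδ' ?_
    rw [← coeIdeal_le_coeIdeal K, hJ] at h
    rw [← spanSingleton_le_iff_mem]
    have h2 := mul_le_mul_left h ((P : FractionalIdeal (𝓞 K)⁰ K)⁻¹ * codifferent K)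
    rwa [← hI0, mul_assoc, mul_inv_cancel₀ hIne, mul_one, hI0, mul_inv_cancel_left₀ hP'] at h2
  obtain ⟨j, hj, hjP⟩ := SetLike.not_le_iff_exists.mp hJP
  obtain ⟨y, p, hp, hyp⟩ := hPmax.exists_inv hjP
  have hjδ : (j : K) ∈ spanSingleton (𝓞 K)⁰ δ * I := hJ ▸ mem_coeIdeal_of_mem _ hj
  obtain ⟨t, ht, htj⟩ := mem_singleton_mul.mp hjδ
  refine ⟨y * t, ?_, ?_⟩
  · exact Submodule.smul_mem I.coeToSubmodule y ht
  · have h1 : (1 : K) - y * t * δ = p := by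
      rw [mul_assoc, mul_comm t, ← htj, ← map_one (algebraMap (𝓞 K) K), ← hyp, map_add, map_mul]
      ring
    rw [h1]
    exact mem_coeIdeal_of_mem _ hp

theorem isSymplecticLattice_codeLattice {P : Ideal (𝓞 K)} (hP : P ≠ ⊥) (hPp : P.IsPrime)
    {C : Submodule (𝓞 K ⧸ P) (CodeSpace P)} (hC : Module.finrank (𝓞 K ⧸ P) C = 1) :
    IsSymplecticLattice (codeLattice P C) := by
  have hP' : (P : FractionalIdeal (𝓞 K)⁰ K) ≠ 0 := coeIdeal_ne_zero.mpr hP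
  have hα := (scalingFactor_pos hP).ne'
  have hP1 : ∀ a ∈ (P : FractionalIdeal (𝓞 K)⁰ K), a ∈ (1 : FractionalIdeal (𝓞 K)⁰ K) :=
    fun a ha => coeIdeal_le_one ha
  have hDP : ∀ b ∈ codifferent K, b ∈ (P : FractionalIdeal (𝓞 K)⁰ K)⁻¹ * codifferent K := by
    intro b hb
    rw [← one_mul b]
    exact mul_mem_mul ((mem_inv_iff hP').mpr fun y hy => by rw [one_mul]; exact hP1 y hy) hb
  obtain ⟨a₀, ha₀, b₀, hb₀, hv, hgen⟩ := exists_generator_coords hc hP hPp hC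
  have hsub : ∀ a ∈ (P : FractionalIdeal (𝓞 K)⁰ K), ∀ b ∈ codifferent K,
      scaledPoint P a b ∈ codeLattice P C := fun a ha b hb =>
    (hgen a (hP1 a ha) b (hDP b hb)).mpr ⟨0, by simpa using ha, by simpa using hb⟩
  have hbase : ∀ w ∈ codeLattice P C, ∃ a ∈ (1 : FractionalIdeal (𝓞 K)⁰ K),
      ∃ b ∈ (P : FractionalIdeal (𝓞 K)⁰ K)⁻¹ * codifferent K, w = scaledPoint P a b := by
    intro w hw
    obtain ⟨h, _⟩ := (mem_codeLattice P C w).mp hw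
    exact (mem_baseLattice hc P w).mp h
  have hint : ∀ w ∈ codeLattice P C, ∀ z ∈ codeLattice P C,
      ∃ k : ℤ, inner ℝ (symplecticRotation hc w) z = k := by
    intro w hw z hz
    obtain ⟨a, ha, b, hb, rfl⟩ := hbase w hw
    obtain ⟨a', ha', b', hb', rfl⟩ := hbase z hz
    obtain ⟨r, hr, hr'⟩ := (hgen a ha b hb).mp hw
    obtain ⟨s, hs, hs'⟩ := (hgen a' ha' b' hb').mp hz
    rw [inner_symplecticRotation_scaledPoint hc hP, ← mul_one (a * b' - b * a')]
    refine exists_realTrace_eq_intCast (one_ne_zero : (1 : FractionalIdeal (𝓞 K)⁰ K) ≠ 0)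
      (one_mem_one _) ?_
    have h1 := det_mem_codifferent hP ha hb hs hs'
    have h2 := Submodule.smul_mem (codifferent K).coeToSubmodule s
      (det_mem_codifferent hP ha₀ hb₀ hr hr')
    -- With generator v, w ∧ z = w ∧ (z - sv) - s · (v ∧ (w - rv)), since v ∧ v = 0; both wedges on
    -- the right have one factor in PΛ₀.
    convert! Submodule.sub_mem _ h1 h2 using 1
    rw [Algebra.smul_def]
    ring
  have hspan : Submodule.span ℝ (codeLattice P C : Set (RealPlane K)) = ⊤ := by
    let i₁ : RealSpace K →ₗ[ℝ] RealPlane K :=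
      (WithLp.linearEquiv 2 ℝ _).symm.toLinearMap ∘ₗ LinearMap.inl ℝ _ _
    let i₂ : RealSpace K →ₗ[ℝ] RealPlane K :=
      (WithLp.linearEquiv 2 ℝ _).symm.toLinearMap ∘ₗ LinearMap.inr ℝ _ _
    set S := Submodule.span ℝ (codeLattice P C : Set (RealPlane K))
    have h1 : S.comap i₁ = ⊤ := by
      rw [eq_top_iff, ← span_fractionalIdeal hP', Submodule.span_le]
      rintro _ ⟨a, ha, rfl⟩
      have h := S.smul_mem (scalingFactor P)
        (Submodule.subset_span (hsub a ha 0 (zero_mem _)))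
      rw [scaledPoint, map_zero, smul_zero, ← WithLp.toLp_smul, Prod.smul_mk, smul_smul,
        mul_inv_cancel₀ hα, one_smul, smul_zero] at h
      exact h
    have h2 : S.comap i₂ = ⊤ := by
      rw [eq_top_iff, ← span_fractionalIdeal (codifferent_ne_zero (K := K)), Submodule.span_le]
      rintro _ ⟨b, hb, rfl⟩
      have h := S.smul_mem (scalingFactor P)⁻¹
        (Submodule.subset_span (hsub 0 (zero_mem _) b hb))
      rw [scaledPoint, map_zero, smul_zero, ← WithLp.toLp_smul, Prod.smul_mk, smul_smul,
        inv_mul_cancel₀ hα, one_smul, smul_zero] at h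
      exact h
    rw [eq_top_iff]
    intro x _
    have hx : x = i₁ x.fst + i₂ x.snd := by
      refine WithLp.ofLp_injective 2 (Prod.ext ?_ ?_) <;> simp [i₁, i₂]
    rw [hx]
    exact S.add_mem (h1.symm ▸ Submodule.mem_top : x.fst ∈ S.comap i₁)
      (h2.symm ▸ Submodule.mem_top : x.snd ∈ S.comap i₂)
  have hdual : ∀ w, (∀ z ∈ codeLattice P C, ∃ k : ℤ, inner ℝ (symplecticRotation hc w) z = k) →
      w ∈ codeLattice P C := by
    intro w hw
    have hinner : ∀ a b : K, inner ℝ (symplecticRotation hc w) (scaledPoint P a b) =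
        realTrace ((scalingFactor P • w.fst) * algebraMap K (RealSpace K) b) -
        realTrace (((scalingFactor P)⁻¹ • w.snd) * algebraMap K (RealSpace K) a) := by
      intro a b
      rw [inner_symplecticRotation]
      simp [scaledPoint]
    -- Integrality against the sublattice PΛ₀ = P × D alone places w in Λ₀, as the trace duals of D
    -- and P are O_K and P⁻¹D.
    obtain ⟨a, ha, hwa⟩ := exists_mem_dual_of_realTrace_mul hc
      (codifferent_ne_zero (K := K)) (x := scalingFactor P • w.fst) fun b hb => by
        obtain ⟨k, hk⟩ := hw _ (hsub 0 (zero_mem _) b hb)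
        exact ⟨k, by rw [← hk, hinner]; simp⟩
    obtain ⟨b, hb, hwb⟩ := exists_mem_dual_of_realTrace_mul hc
      hP' (x := (scalingFactor P)⁻¹ • w.snd) fun a ha => by
        obtain ⟨k, hk⟩ := hw _ (hsub a ha 0 (zero_mem _))
        exact ⟨-k, by rw [Int.cast_neg, ← hk, hinner]; simp⟩
    rw [dual_dual] at ha
    rw [dual_eq_mul_inv, mul_comm] at hb
    have hwab : w = scaledPoint P a b := by
      refine WithLp.ofLp_injective 2 (Prod.ext ?_ ?_)
      · change w.fst = (scalingFactor P)⁻¹ • algebraMap K (RealSpace K) a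
        rw [← hwa, smul_smul, inv_mul_cancel₀ hα, one_smul]
      · change w.snd = scalingFactor P • algebraMap K (RealSpace K) b
        rw [← hwb, smul_smul, mul_inv_cancel₀ hα, one_smul]
    -- All O_K-multiples of the generator (a₀, b₀) lie in Λ_C, so integrality against them bounds
    -- the whole determinant and not only its trace.
    have hdet : a * b₀ - b * a₀ ∈ codifferent K := by
      rw [mem_dual (one_ne_zero : (1 : FractionalIdeal (𝓞 K)⁰ K) ≠ 0)]
      intro r hr
      obtain ⟨r, rfl⟩ := (mem_one_iff _).mp hr
      have h1 : scaledPoint P (r * a₀) (r * b₀) ∈ codeLattice P C :=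
        (hgen _ (Submodule.smul_mem (1 : FractionalIdeal (𝓞 K)⁰ K).coeToSubmodule r ha₀) _
          (Submodule.smul_mem ((P : FractionalIdeal (𝓞 K)⁰ K)⁻¹ * codifferent K).coeToSubmodule
            r hb₀)).mpr ⟨r, (sub_self (r * a₀ : K)).symm ▸ zero_mem _,
              (sub_self (r * b₀ : K)).symm ▸ zero_mem _⟩
      obtain ⟨k, hk⟩ := hw _ h1
      refine ⟨k, ?_⟩
      rw [hwab, inner_symplecticRotation_scaledPoint hc hP, realTrace_algebraMap] at hk
      rw [Algebra.traceForm_apply]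
      have hk' : Algebra.trace ℚ K (a * (r * b₀) - b * (r * a₀)) = (k : ℚ) := by exact_mod_cast hk
      rw [show (a * b₀ - b * a₀) * r = a * (r * b₀) - b * (r * a₀) by ring, hk']
      simp
    -- Nondegeneracy: if the generator were orthogonal to all of Λ₀, the vectors (0, z) would force
    -- a₀ ∈ P and (1, 0) would force b₀ ∈ D.
    obtain ⟨u, hu, u', hu', hδ'⟩ : ∃ u ∈ (1 : FractionalIdeal (𝓞 K)⁰ K),
        ∃ u' ∈ (P : FractionalIdeal (𝓞 K)⁰ K)⁻¹ * codifferent K,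
          a₀ * u' - b₀ * u ∉ codifferent K := by
      by_contra! h
      refine hv ⟨?_, ?_⟩
      · have h1 : spanSingleton (𝓞 K)⁰ a₀ *
            ((P : FractionalIdeal (𝓞 K)⁰ K)⁻¹ * codifferent K) ≤ codifferent K :=
          spanSingleton_mul_le_iff.mpr fun z hz => by simpa using h 0 (zero_mem _) z hz
        have h2 := mul_le_mul_left h1 ((P : FractionalIdeal (𝓞 K)⁰ K) * (codifferent K)⁻¹)
        rw [mul_left_comm (codifferent K), mul_inv_cancel₀ codifferent_ne_zero, mul_one, mul_assoc,
          mul_mul_mul_comm, inv_mul_cancel₀ hP', one_mul, mul_inv_cancel₀ codifferent_ne_zero,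
          mul_one] at h2
        exact spanSingleton_le_iff_mem.mp h2
      · have h1 := h 1 (one_mem_one _) 0 (zero_mem _)
        rw [mul_zero, zero_sub, mul_one] at h1
        exact neg_mem_iff (S := Submodule (𝓞 K) K) |>.mp h1
    have hmem : ∀ {x x' y y'}, x ∈ (1 : FractionalIdeal (𝓞 K)⁰ K) →
        x' ∈ (P : FractionalIdeal (𝓞 K)⁰ K)⁻¹ * codifferent K →
        y ∈ (1 : FractionalIdeal (𝓞 K)⁰ K) →
        y' ∈ (P : FractionalIdeal (𝓞 K)⁰ K)⁻¹ * codifferent K →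
        x * y' - x' * y ∈ (P : FractionalIdeal (𝓞 K)⁰ K)⁻¹ * codifferent K := by
      intro x x' y y' hx hx' hy hy'
      refine Submodule.sub_mem _ ?_ ?_
      · rw [← one_mul ((P : FractionalIdeal (𝓞 K)⁰ K)⁻¹ * codifferent K)]
        exact mul_mem_mul hx hy'
      · rw [← mul_one ((P : FractionalIdeal (𝓞 K)⁰ K)⁻¹ * codifferent K)]
        exact mul_mem_mul hx' hy
    obtain ⟨t, ht, ht'⟩ := exists_mul_sub_one_mem hP hPp (hmem ha₀ hb₀ hu hu') hδ'
    have hr : t * (a * u' - b * u) ∈ (1 : FractionalIdeal (𝓞 K)⁰ K) := by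
      have h := mul_mem_mul ht (hmem ha hb hu hu')
      rwa [mul_mul_mul_comm, mul_inv_cancel₀ hP', one_mul, inv_mul_cancel₀ codifferent_ne_zero]
        at h
    have hs : t * (a * b₀ - b * a₀) ∈ (P : FractionalIdeal (𝓞 K)⁰ K) := by
      have h := mul_mem_mul ht hdet
      rwa [mul_assoc, inv_mul_cancel₀ codifferent_ne_zero, mul_one] at h
    have hPD : ∀ {p y}, p ∈ (P : FractionalIdeal (𝓞 K)⁰ K) →
        y ∈ (P : FractionalIdeal (𝓞 K)⁰ K)⁻¹ * codifferent K → p * y ∈ codifferent K := by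
      intro p y hp hy
      have h := mul_mem_mul hp hy
      rwa [mul_inv_cancel_left₀ hP'] at h
    have hP1' : ∀ {p y}, p ∈ (P : FractionalIdeal (𝓞 K)⁰ K) →
        y ∈ (1 : FractionalIdeal (𝓞 K)⁰ K) → p * y ∈ (P : FractionalIdeal (𝓞 K)⁰ K) := by
      intro p y hp hy
      have h := mul_mem_mul hp hy
      rwa [mul_one] at h
    obtain ⟨r, hr⟩ := (mem_one_iff _).mp hr
    replace hr : (r : K) = _ := hr
    rw [hwab, hgen a ha b hb]
    -- Cramer's rule. With δ = a₀u' - b₀u, s = t(ab₀ - ba₀) ∈ P and r = t(au' - bu), one has a - ra₀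
    -- = (1 - tδ)a - su and b - rb₀ = (1 - tδ)b - su'.
    refine ⟨r, ?_, ?_⟩
    · rw [hr]
      convert! Submodule.sub_mem _ (hP1' ht' ha) (hP1' hs hu) using 1
      ring
    · rw [hr]
      convert! Submodule.sub_mem _ (hPD ht' hb) (hPD hs hu') using 1
      ring
  have hneg : ∀ y : RealPlane K, symplecticRotation hc (-symplecticRotation hc y) = y := by
    intro y
    rw [map_neg, symplecticRotation_symplecticRotation, neg_neg]
  refine ⟨⟨?_, hspan⟩, symplecticRotation hc, ?_, symplecticRotation_symplecticRotation hc⟩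
  -- Λ_C pairs integrally with its own image under the rotation, which spans E.
  · refine discreteTopology_of_inner_int (M := symplecticRotation hc '' (codeLattice P C)) ?_ ?_
    · have h := (Submodule.span_image (symplecticRotation hc).toLinearEquiv.toLinearMap
        (s := (codeLattice P C : Set (RealPlane K))))
      rw [hspan, Submodule.map_top, LinearEquiv.range] at h
      exact h
    · rintro x hx _ ⟨z, hz, rfl⟩
      rw [real_inner_comm]
      exact hint z hz x hx
  · ext y
    constructor
    · rintro ⟨w, hw, rfl⟩ z hz
      exact hint w hw z hz
    · intro hy
      refine ⟨-symplecticRotation hc y, hdual _ ?_, hneg y⟩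
      rw [hneg]
      exact hy

end CodeLattice

/-! ### Covolume, point counting and covering radius -/

section LatticeVolume

variable {E : Type*} [NormedAddCommGroup E] [InnerProductSpace ℝ E] [FiniteDimensional ℝ E]

section Covolume

variable [MeasurableSpace E] [BorelSpace E]

theorem covolume_eq_abs_det_orthonormalBasis {ι : Type*} [Fintype ι] [DecidableEq ι]
    (Λ : Submodule ℤ E) [DiscreteTopology Λ] [IsZLattice ℝ Λ] (b : Module.Basis ι ℤ Λ)
    (o : OrthonormalBasis ι ℝ E) :
    ZLattice.covolume Λ = |(o.toBasis.toMatrix fun i => (b i : E)).det| := by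
  have h : (volume : Measure E).real (ZSpan.fundamentalDomain o.toBasis) = 1 := by
    rw [measureReal_congr (ZSpan.fundamentalDomain_ae_parallelepiped o.toBasis volume),
      OrthonormalBasis.coe_toBasis, measureReal_def, o.volume_parallelepiped, ENNReal.toReal_one]
  rw [ZLattice.covolume_eq_det_mul_measureReal Λ volume b o.toBasis, h, mul_one,
    Module.Basis.det_apply]
  rfl

omit [FiniteDimensional ℝ E] [MeasurableSpace E] [BorelSpace E] in
theorem gram_eq_transpose_mul {ι : Type*} [Fintype ι] [DecidableEq ι] (o : OrthonormalBasis ι ℝ E)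
    (v w : ι → E) :
    (Matrix.of fun i j => inner ℝ (v i) (w j)) =
      (o.toBasis.toMatrix v).transpose * o.toBasis.toMatrix w := by
  ext i j
  simp only [Matrix.of_apply, Matrix.mul_apply, Matrix.transpose_apply,
    Module.Basis.toMatrix_apply, OrthonormalBasis.coe_toBasis_repr_apply,
    OrthonormalBasis.repr_apply_apply]
  rw [← o.sum_inner_mul_inner (v i) (w j)]
  refine Finset.sum_congr rfl fun k _ => ?_
  rw [real_inner_comm]

/-- The matrix J = (⟨σbᵢ, bⱼ⟩) is integral, and it is invertible over ℤ because the dual basis of b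
is an integral combination of the σbₖ. So |det J| = 1, while |det J| is the square of the covolume
since σ is an isometry. -/
theorem covolume_eq_one_of_isSymplecticLattice {Λ : Submodule ℤ E} (hΛ : IsSymplecticLattice Λ) :
    ZLattice.covolume Λ = 1 := by
  classical
  obtain ⟨⟨hd, hs⟩, σ, hσ, -⟩ := hΛ
  have : IsZLattice ℝ Λ := ⟨hs⟩
  have := ZLattice.module_free ℝ Λ
  have := ZLattice.module_finite ℝ Λ
  let b := Module.Free.chooseBasis ℤ Λ
  let bR := b.ofZLatticeBasis ℝ Λ
  let o : OrthonormalBasis _ ℝ E := (stdOrthonormalBasis ℝ E).reindex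
    ((Module.finBasis ℝ E).indexEquiv bR)
  rw [covolume_eq_abs_det_orthonormalBasis Λ b o]
  have hint : ∀ i j, ∃ k : ℤ, inner ℝ (σ (b i)) (b j : E) = k := fun i j =>
    (hσ ▸ Set.mem_image_of_mem σ (b i).2 : σ (b i) ∈ (dualLattice Λ : Set E)) _ (b j).2
  choose J hJ using hint
  let f : _ → E := fun i =>
    (InnerProductSpace.toDual ℝ E).symm (LinearMap.toContinuousLinearMap (bR.coord i))
  have hf : ∀ i x, inner ℝ (f i) x = bR.repr x i := fun i x => by
    simp [f, InnerProductSpace.toDual_symm_apply]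
  have hfdual : ∀ i, ∃ l : Λ, σ l = f i := by
    intro i
    have h : f i ∈ (dualLattice Λ : Set E) := by
      intro y hy
      refine ⟨b.repr ⟨y, hy⟩ i, ?_⟩
      rw [hf]
      exact b.ofZLatticeBasis_repr_apply ℝ Λ ⟨y, hy⟩ i
    rw [← hσ] at h
    obtain ⟨l, hl, hl'⟩ := h
    exact ⟨⟨l, hl⟩, hl'⟩
  choose l hl using hfdual
  have hNJ : (Matrix.of fun i j => b.repr (l i) j) * Matrix.of J = 1 := by
    ext i j
    have h1 : f i = ∑ k, (b.repr (l i) k : ℝ) • σ (b k) := by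
      rw [← hl]
      conv_lhs => rw [← b.sum_repr (l i)]
      simp only [Submodule.coe_sum, Submodule.coe_smul, map_sum, Int.cast_smul_eq_zsmul, map_zsmul]
    have h2 := hf i (b j)
    rw [h1, sum_inner] at h2
    simp only [real_inner_smul_left, hJ] at h2
    have h3 : bR.repr (b j : E) i = (b.repr (b j) i : ℝ) := b.ofZLatticeBasis_repr_apply ℝ Λ (b j) i
    rw [h3, Module.Basis.repr_self] at h2
    rw [Matrix.mul_apply, Matrix.one_apply]
    simp only [Matrix.of_apply]
    have h4 : ∑ k, b.repr (l i) k * J k j = Finsupp.single j 1 i := by exact_mod_cast h2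
    rw [h4, Finsupp.single_apply]
    simp only [eq_comm]
  have hdetJ : |(Matrix.of J).det| = 1 := by
    have h := congrArg Matrix.det hNJ
    rw [Matrix.det_mul, Matrix.det_one] at h
    exact Int.isUnit_iff_abs_eq.mp (IsUnit.of_mul_eq_one_right _ h)
  set A := o.toBasis.toMatrix fun i => (b i : E)
  set A' := o.toBasis.toMatrix fun i => σ (b i : E)
  have h1 : A'.transpose * A = (Matrix.of J).map (Int.cast : ℤ → ℝ) := by
    rw [← gram_eq_transpose_mul]
    ext i j
    simp [hJ]
  have h2 : A'.transpose * A' = A.transpose * A := by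
    rw [← gram_eq_transpose_mul, ← gram_eq_transpose_mul]
    ext i j
    simp
  have h3 : |A'.det * A.det| = 1 := by
    have h := congrArg Matrix.det h1
    rw [Matrix.det_mul, Matrix.det_transpose] at h
    rw [h, show ((Matrix.of J).map (Int.cast : ℤ → ℝ)).det = ((Matrix.of J).det : ℝ) from
      ((Int.castRingHom ℝ).map_det (Matrix.of J)).symm]
    exact_mod_cast hdetJ
  have h4 : |A'.det| = |A.det| := by
    have h := congrArg Matrix.det h2
    rw [Matrix.det_mul, Matrix.det_transpose, Matrix.det_mul, Matrix.det_transpose] at h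
    exact abs_eq_abs.mpr (mul_self_eq_mul_self_iff.mp h)
  rw [abs_mul, h4] at h3
  nlinarith [abs_nonneg A.det]

/-- For x in a fundamental domain choose v ∈ Λ within ρ of x. The points w + (x - v), w ∈ s, are
distinct Λ-translates of x in the ball of radius r + ρ. Integrating their number over the domain
unfolds to the volume of the ball. -/
theorem card_mul_covolume_le {Λ : Submodule ℤ E} [DiscreteTopology Λ] [IsZLattice ℝ Λ] {ρ r : ℝ}
    (hρ : ∀ x : E, ∃ v ∈ Λ, ‖x - v‖ ≤ ρ) {s : Finset E} (hs : ∀ v ∈ s, v ∈ Λ ∧ ‖v‖ ≤ r) :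
    s.card * ZLattice.covolume Λ ≤ (volume : Measure E).real (Metric.closedBall 0 (r + ρ)) := by
  classical
  have := ZLattice.module_free ℝ Λ
  have := ZLattice.module_finite ℝ Λ
  have : VAddInvariantMeasure Λ E volume :=
    (inferInstance : VAddInvariantMeasure Λ.toAddSubgroup E volume)
  have : MeasurableVAdd Λ E := (inferInstance : MeasurableVAdd Λ.toAddSubgroup E)
  have : MeasurableConstVAdd Λ E := inferInstance
  let F := ZSpan.fundamentalDomain ((Module.Free.chooseBasis ℤ Λ).ofZLatticeBasis ℝ Λ)
  have hF : IsAddFundamentalDomain Λ F volume :=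
    ZLattice.isAddFundamentalDomain (Module.Free.chooseBasis ℤ Λ) volume
  have hFfin : volume F ≠ ⊤ := (ZSpan.fundamentalDomain_isBounded _).measure_lt_top.ne
  let B : Set E := Metric.closedBall 0 (r + ρ)
  have hB : MeasurableSet B := Metric.isClosed_closedBall.measurableSet
  rw [ZLattice.covolume_eq_measure_fundamentalDomain Λ volume hF]
  have h1 : (s.card : ENNReal) * volume F ≤ volume B := by
    calc (s.card : ENNReal) * volume F = ∫⁻ _ in F, (s.card : ENNReal) := by
          rw [setLIntegral_const]
      _ ≤ ∫⁻ x in F, ∑' g : Λ, B.indicator 1 (-g +ᵥ x) := by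
          refine lintegral_mono fun x => ?_
          obtain ⟨v, hv, hxv⟩ := hρ x
          let g : s → Λ := fun w => ⟨v, hv⟩ - ⟨w, (hs w w.2).1⟩
          have hg : Function.Injective g := by
            intro w w' h
            have h' : v - (w : E) = v - (w' : E) := congrArg Subtype.val h
            exact Subtype.ext (sub_right_injective h')
          calc (s.card : ENNReal) = ∑ w : s, B.indicator 1 (-(g w) +ᵥ x) := by
                rw [← Fintype.card_coe, ← Finset.card_univ, Finset.cast_card]
                refine Finset.sum_congr rfl fun w _ => ?_
                rw [Set.indicator_of_mem, Pi.one_apply]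
                have h1 : -(g w) +ᵥ x = w + (x - v) := by
                  change -(v - (w : E)) + x = w + (x - v)
                  abel
                rw [h1, mem_closedBall_zero_iff]
                exact (norm_add_le _ _).trans (add_le_add (hs w w.2).2 hxv)
            _ = ∑ g' ∈ Finset.univ.image g, B.indicator 1 (-g' +ᵥ x) := by
                rw [Finset.sum_image fun _ _ _ _ h => hg h]
            _ ≤ _ := ENNReal.sum_le_tsum _
      _ = ∑' g : Λ, ∫⁻ x in F, B.indicator 1 (-g +ᵥ x) := by
          refine lintegral_tsum fun g => ?_
          exact ((measurable_one.indicator hB).comp (measurable_const_vadd (-g))).aemeasurable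
      _ = ∫⁻ x, B.indicator 1 x := (hF.lintegral_eq_tsum' _).symm
      _ = volume B := by rw [lintegral_indicator_one hB]
  have hBfin : volume B ≠ ⊤ := Metric.isBounded_closedBall.measure_lt_top.ne
  have h2 := ENNReal.toReal_mono hBfin h1
  rwa [ENNReal.toReal_mul, ENNReal.toReal_natCast] at h2

end Covolume

-- Round one coordinate at a time. If t is the fractional part, rounding down with weight 1 - t and
-- up with weight t gives an error of mean 0 and variance t(1 - t) ≤ 1/4, so one of the two adds at
-- most ‖v a‖²/4 to the squared norm, whatever the earlier error u is.
omit [FiniteDimensional ℝ E] in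
theorem exists_int_norm_sq_sum_le {ι : Type*} (s : Finset ι) (v : ι → E) (f : ι → ℝ) :
    ∃ k : ι → ℤ, ‖∑ i ∈ s, (f i - k i) • v i‖ ^ 2 ≤ (∑ i ∈ s, ‖v i‖ ^ 2) / 4 := by
  classical
  induction s using Finset.induction_on with
  | empty => exact ⟨0, by simp⟩
  | insert a s ha ih =>
    obtain ⟨k, hk⟩ := ih
    set u := ∑ i ∈ s, (f i - k i) • v i
    have hexp : ∀ e : ℝ, ‖e • v a + u‖ ^ 2 = e ^ 2 * ‖v a‖ ^ 2 + 2 * e * inner ℝ (v a) u + ‖u‖ ^ 2 := by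
      intro e
      rw [norm_add_sq_real, norm_smul, real_inner_smul_left, mul_pow, Real.norm_eq_abs, sq_abs]
      ring
    have hstep : ∃ n : ℤ, ‖(f a - n) • v a + u‖ ^ 2 ≤ ‖u‖ ^ 2 + ‖v a‖ ^ 2 / 4 := by
      by_contra! h
      have h0 := h ⌊f a⌋
      have h1 := h (⌊f a⌋ + 1)
      have hf0 := Int.fract_nonneg (f a)
      have hf1 := Int.fract_lt_one (f a)
      have e0 : f a - (⌊f a⌋ : ℝ) = Int.fract (f a) := rfl
      have e1 : f a - ((⌊f a⌋ + 1 : ℤ) : ℝ) = Int.fract (f a) - 1 := by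
        push_cast; rw [← e0]; ring
      rw [hexp, e0] at h0
      rw [hexp, e1] at h1
      set t := Int.fract (f a)
      have hv := sq_nonneg ‖v a‖
      nlinarith [mul_nonneg hv (sq_nonneg (t - 1 / 2)), mul_le_mul_of_nonneg_left h1.le hf0,
        mul_lt_mul_of_pos_left h0 (sub_pos.mpr hf1)]
    obtain ⟨n, hn⟩ := hstep
    refine ⟨Function.update k a n, ?_⟩
    rw [Finset.sum_insert ha, Finset.sum_insert ha, Function.update_self]
    have h2 : ∑ i ∈ s, (f i - (Function.update k a n i : ℤ)) • v i = u :=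
      Finset.sum_congr rfl fun i hi => by
        rw [Function.update_of_ne (ne_of_mem_of_not_mem hi ha)]
    rw [h2]
    linarith

omit [FiniteDimensional ℝ E] in
theorem exists_mem_norm_sub_le {ι : Type*} [Fintype ι] {Λ : Submodule ℤ E} {v : ι → E}
    (hv : ∀ i, v i ∈ Λ) (hspan : Submodule.span ℝ (Set.range v) = ⊤) {ρ : ℝ} (hρ0 : 0 ≤ ρ)
    (hρ : (∑ i, ‖v i‖ ^ 2) / 4 ≤ ρ ^ 2) (x : E) : ∃ w ∈ Λ, ‖x - w‖ ≤ ρ := by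
  obtain ⟨f, rfl⟩ := (Submodule.mem_span_range_iff_exists_fun ℝ).mp
    (hspan ▸ Submodule.mem_top : x ∈ Submodule.span ℝ (Set.range v))
  obtain ⟨k, hk⟩ := exists_int_norm_sq_sum_le Finset.univ v f
  refine ⟨∑ i, k i • v i, Submodule.sum_mem _ fun i _ => Λ.smul_mem _ (hv i), ?_⟩
  have h : ∑ i, f i • v i - ∑ i, k i • v i = ∑ i, (f i - k i) • v i := by
    simp only [sub_smul, Int.cast_smul_eq_zsmul, Finset.sum_sub_distrib]
  rw [h]
  exact abs_le_of_sq_le_sq' (hk.trans hρ) hρ0 |>.2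

end LatticeVolume

/-! ### Ideal norms: lower bounds for lengths, and small elements -/

section NormEstimates

open FractionalIdeal nonZeroDivisors RealSpace Module

variable {K : Type*} [Field K] [NumberField K]

/-- Arithmetic-geometric mean inequality for the numbers |τ(x)|². -/
theorem finrank_mul_norm_rpow_le (x : K) :
    (finrank ℚ K : ℝ) * |((Algebra.norm ℚ x : ℚ) : ℝ)| ^ (2 / (finrank ℚ K : ℝ)) ≤
      ‖algebraMap K (RealSpace K) x‖ ^ 2 := by
  have hn : (0 : ℝ) < finrank ℚ K := by exact_mod_cast finrank_pos
  have hcard : (Fintype.card (K →+* ℂ) : ℝ) = finrank ℚ K := by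
    rw [NumberField.Embeddings.card]
  have h := Real.geom_mean_le_arith_mean Finset.univ (fun _ : K →+* ℂ => 1) (fun τ => ‖τ x‖ ^ 2)
    (fun _ _ => zero_le_one) (by simp [Fintype.card_pos]) (fun _ _ => sq_nonneg _)
  simp only [Real.rpow_one, Finset.sum_const, Finset.card_univ, nsmul_eq_mul, mul_one, one_mul,
    hcard] at h
  have hprod : ∏ τ : K →+* ℂ, ‖τ x‖ = |((Algebra.norm ℚ x : ℚ) : ℝ)| := by
    have h1 := Algebra.norm_eq_prod_embeddings ℚ ℂ x
    have h2 := congrArg norm h1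
    rw [norm_prod, eq_ratCast, Complex.norm_ratCast] at h2
    rw [h2]
    exact Fintype.prod_equiv (RingHom.equivRatAlgHom K ℂ) _ _ fun τ => rfl
  rw [Finset.prod_pow, hprod, ← Real.rpow_natCast, ← Real.rpow_mul (abs_nonneg _), Nat.cast_ofNat,
    ← div_eq_mul_inv, le_div_iff₀ hn] at h
  rw [norm_sq, mul_comm]
  simpa only [embed_algebraMap] using h

/-- The principal ideal (x) is J · I with J a nonzero integral ideal, whose norm is at least 1. -/
theorem absNorm_le_abs_norm {I : FractionalIdeal (𝓞 K)⁰ K} {x : K} (hx : x ∈ I) (hx0 : x ≠ 0) :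
    absNorm I ≤ |Algebra.norm ℚ x| := by
  have hI : I ≠ 0 := by
    rintro rfl
    exact hx0 ((mem_zero_iff _).mp hx)
  have hle : spanSingleton (𝓞 K)⁰ x * I⁻¹ ≤ 1 := by
    rw [← mul_inv_cancel₀ hI]
    exact mul_le_mul_left (spanSingleton_le_iff_mem.mpr hx) _
  obtain ⟨J, hJ⟩ := le_one_iff_exists_coeIdeal.mp hle
  have hJI : (J : FractionalIdeal (𝓞 K)⁰ K) * I = spanSingleton (𝓞 K)⁰ x := by
    rw [hJ, inv_mul_cancel_right₀ hI]
  have hJ0 : J ≠ ⊥ := by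
    rintro rfl
    rw [coeIdeal_bot, zero_mul, eq_comm, spanSingleton_eq_zero_iff] at hJI
    exact hx0 hJI
  rw [← absNorm_span_singleton (R := 𝓞 K), ← hJI, map_mul, coeIdeal_absNorm]
  have h1 : 1 ≤ Ideal.absNorm J :=
    Nat.one_le_iff_ne_zero.mpr (Ideal.absNorm_eq_zero_iff.not.mpr hJ0)
  exact le_mul_of_one_le_left (absNorm_nonneg I) (by exact_mod_cast h1)

theorem absNorm_coe_eq_residueCard (P : Ideal (𝓞 K)) :
    absNorm (P : FractionalIdeal (𝓞 K)⁰ K) = residueCard P := by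
  rw [coeIdeal_absNorm, Ideal.absNorm_apply, Submodule.cardQuot_apply]
  rfl

theorem absNorm_codifferent :
    absNorm (codifferent K) = |(NumberField.discr K : ℚ)|⁻¹ := by
  have h := congrArg absNorm (coeIdeal_differentIdeal ℤ ℚ K (𝓞 K))
  rw [coeIdeal_absNorm, map_inv₀, NumberField.absNorm_differentIdeal (K := K)] at h
  rw [← inv_inv (absNorm (codifferent K)), ← h, Nat.cast_natAbs, Int.cast_abs]

theorem scalingFactor_sq {P : Ideal (𝓞 K)} :
    scalingFactor P ^ 2 = ((residueCard P : ℝ) * |(NumberField.discr K : ℝ)|) ^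
      (1 / (finrank ℚ K : ℝ)) := by
  rw [scalingFactor, ← Real.rpow_natCast, ← Real.rpow_mul (by positivity)]
  congr 1
  push_cast
  field_simp

theorem norm_scaledPoint_sq {P : Ideal (𝓞 K)} (a b : K) :
    ‖scaledPoint P a b‖ ^ 2 = (scalingFactor P ^ 2)⁻¹ * ‖algebraMap K (RealSpace K) a‖ ^ 2 +
      scalingFactor P ^ 2 * ‖algebraMap K (RealSpace K) b‖ ^ 2 := by
  rw [WithLp.prod_norm_sq_eq_of_L2, scaledPoint, WithLp.toLp_fst, WithLp.toLp_snd, norm_smul,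
    norm_smul, mul_pow, mul_pow, norm_inv, Real.norm_eq_abs, inv_pow, sq_abs]

/-- A nonzero a has norm at least q and a nonzero b at least 1/|d_K|; α is the scaling for which the
two resulting bounds coincide. -/
theorem le_norm_scaledPoint_sq {P : Ideal (𝓞 K)} (hP : P ≠ ⊥) {a b : K}
    (ha : a ∈ (P : FractionalIdeal (𝓞 K)⁰ K)) (hb : b ∈ codifferent K) (hab : a ≠ 0 ∨ b ≠ 0) :
    (finrank ℚ K : ℝ) * ((residueCard P : ℝ) ^ (1 / (finrank ℚ K : ℝ)) /
      |(NumberField.discr K : ℝ)| ^ (1 / (finrank ℚ K : ℝ))) ≤ ‖scaledPoint P a b‖ ^ 2 := by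
  have hq : (0 : ℝ) < residueCard P := by exact_mod_cast residueCard_pos hP
  have hd : (0 : ℝ) < |(NumberField.discr K : ℝ)| := one_pos.trans_le one_le_abs_discr
  have hn : (0 : ℝ) < finrank ℚ K := by exact_mod_cast finrank_pos
  rw [norm_scaledPoint_sq, scalingFactor_sq]
  set q := (residueCard P : ℝ)
  set d : ℝ := |(NumberField.discr K : ℝ)| with hd_def
  set n := (finrank ℚ K : ℝ)
  have hpow : ∀ x : ℝ, 0 < x → x ^ (2 / n) = x ^ (1 / n) * x ^ (1 / n) := fun x hx => by
    rw [← Real.rpow_add hx]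
    congr 1
    ring
  have hqn : 0 < q ^ (1 / n) := Real.rpow_pos_of_pos hq _
  have hdn : 0 < d ^ (1 / n) := Real.rpow_pos_of_pos hd _
  rw [Real.mul_rpow hq.le hd.le]
  have hn2 : (0 : ℝ) ≤ 2 / n := by positivity
  rcases hab with h | h
  · have h1 : q ≤ |((Algebra.norm ℚ a : ℚ) : ℝ)| := by
      have h2 := absNorm_le_abs_norm ha h
      rw [absNorm_coe_eq_residueCard] at h2
      change (residueCard P : ℝ) ≤ _
      exact_mod_cast h2
    have h2 := (mul_le_mul_of_nonneg_left (Real.rpow_le_rpow hq.le h1 hn2) hn.le).trans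
      (finrank_mul_norm_rpow_le a)
    rw [hpow q hq] at h2
    refine le_trans ?_ (le_add_of_nonneg_right (by positivity))
    refine le_trans (le_of_eq ?_) (mul_le_mul_of_nonneg_left h2 (by positivity))
    field_simp
  · have h1 : d⁻¹ ≤ |((Algebra.norm ℚ b : ℚ) : ℝ)| := by
      have h2 := absNorm_le_abs_norm hb h
      rw [absNorm_codifferent] at h2
      have h3 := (Rat.cast_le (K := ℝ)).mpr h2
      rwa [Rat.cast_inv, Rat.cast_abs, Rat.cast_abs, Rat.cast_intCast] at h3
    have h2 := (mul_le_mul_of_nonneg_left (Real.rpow_le_rpow (inv_pos.mpr hd).le h1 hn2) hn.le).trans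
      (finrank_mul_norm_rpow_le b)
    rw [hpow _ (inv_pos.mpr hd), Real.inv_rpow hd.le] at h2
    refine le_trans ?_ (le_add_of_nonneg_left (by positivity))
    refine le_trans (le_of_eq ?_) (mul_le_mul_of_nonneg_left h2 (by positivity))
    field_simp

/-- Minkowski's theorem for the body where all absolute values are below y. Its volume is at least
yⁿ, and 2ⁿ times the covolume is at most 2ⁿx; the constant 3 is just a number larger than 2. -/
theorem exists_ne_zero_mem_forall_norm_le {I : FractionalIdeal (𝓞 K)⁰ K} (hI : I ≠ 0) :
    ∃ a ∈ I, a ≠ 0 ∧ ∀ τ : K →+* ℂ, ‖τ a‖ ≤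
      3 * ((absNorm I : ℝ) * √|(NumberField.discr K : ℝ)|) ^ (1 / (finrank ℚ K : ℝ)) := by
  classical
  have hn : (0 : ℝ) < finrank ℚ K := by exact_mod_cast finrank_pos
  have hN : (0 : ℝ) < absNorm I := by
    exact_mod_cast lt_of_le_of_ne (absNorm_nonneg I) (Ne.symm (absNorm_eq_zero_iff.not.mpr hI))
  have hd : (0 : ℝ) < |(NumberField.discr K : ℝ)| := one_pos.trans_le one_le_abs_discr
  set x : ℝ := (absNorm I : ℝ) * √|(NumberField.discr K : ℝ)| with hx
  have hx0 : 0 < x := by positivity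
  set y : ℝ := 3 * x ^ (1 / (finrank ℚ K : ℝ)) with hy
  have hy0 : 0 < y := by positivity
  have hyn : y ^ finrank ℚ K = 3 ^ finrank ℚ K * x := by
    rw [hy, mul_pow, ← Real.rpow_natCast (x ^ _), ← Real.rpow_mul hx0.le, one_div,
      inv_mul_cancel₀ hn.ne', Real.rpow_one]
  have hlt : NumberField.mixedEmbedding.minkowskiBound K (Units.mk0 I hI) <
      volume (NumberField.mixedEmbedding.convexBodyLT K fun _ => y.toNNReal) := by
    rw [NumberField.mixedEmbedding.minkowskiBound,
      NumberField.mixedEmbedding.volume_fundamentalDomain_fractionalIdealLatticeBasis,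
      NumberField.mixedEmbedding.volume_fundamentalDomain_latticeBasis,
      NumberField.mixedEmbedding.finrank, NumberField.mixedEmbedding.convexBodyLT_volume,
      Finset.prod_pow_eq_pow_sum, NumberField.InfinitePlace.sum_mult_eq]
    have h1 : ((NNReal.sqrt ‖NumberField.discr K‖₊ : NNReal) : ENNReal) =
        ENNReal.ofReal √|(NumberField.discr K : ℝ)| := by
      rw [Real.sqrt, ENNReal.ofReal_coe_nnreal]
      congr 2
      ext
      rw [Real.coe_toNNReal _ (abs_nonneg _), coe_nnnorm, Int.norm_eq_abs]
    have h2 : (2⁻¹ : ENNReal) ^ NumberField.InfinitePlace.nrComplexPlaces K ≤ 1 :=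
      pow_le_one' (ENNReal.inv_le_one.mpr one_le_two) _
    calc _ ≤ ENNReal.ofReal (absNorm I : ℝ) * (1 * ENNReal.ofReal √|(NumberField.discr K : ℝ)|) *
          ENNReal.ofReal (2 ^ finrank ℚ K) := by
          rw [h1, ENNReal.ofReal_pow zero_le_two, ENNReal.ofReal_ofNat]
          gcongr
          rfl
      _ = ENNReal.ofReal (x * 2 ^ finrank ℚ K) := by
          rw [one_mul, ← ENNReal.ofReal_mul hN.le, ← ENNReal.ofReal_mul hx0.le]
      _ < ENNReal.ofReal (y ^ finrank ℚ K) := by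
          rw [ENNReal.ofReal_lt_ofReal_iff (by positivity), hyn, mul_comm]
          exact mul_lt_mul_of_pos_right
            (pow_lt_pow_left₀ (by norm_num) zero_le_two finrank_pos.ne') hx0
      _ = 1 * ((y.toNNReal ^ finrank ℚ K : NNReal) : ENNReal) := by
          rw [one_mul, ENNReal.ofReal_pow hy0.le, ENNReal.coe_pow]
          rfl
      _ ≤ _ := by
          gcongr
          exact_mod_cast NumberField.mixedEmbedding.one_le_convexBodyLTFactor K
  obtain ⟨a, ha, ha0, h⟩ := NumberField.mixedEmbedding.exists_ne_zero_mem_ideal_lt K _ hlt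
  refine ⟨a, ha, ha0, fun τ => ?_⟩
  have h1 := h (NumberField.InfinitePlace.mk τ)
  rw [Real.coe_toNNReal _ hy0.le] at h1
  exact h1.le

end NormEstimates

/-! ### Root of unity action, indices, and the covering radius of Λ₀ -/

section Averaging

open FractionalIdeal nonZeroDivisors RealSpace Module
open scoped LinearAlgebra.Projectivization

variable {K : Type*} [Field K] [NumberField K]

variable (P : Ideal (𝓞 K)) in
/-- `Λ₀` as a lattice of `E`. -/
abbrev baseZLattice : Submodule ℤ (RealPlane K) := (baseLattice P).restrictScalars ℤ

theorem norm_smul_eq_norm {u : K} (hu : ∀ τ : K →+* ℂ, ‖τ u‖ = 1) (x : RealPlane K) :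
    ‖u • x‖ = ‖x‖ := by
  have h : ∀ y : RealSpace K, ‖u • y‖ ^ 2 = ‖y‖ ^ 2 := fun y => by
    simp only [norm_sq, embed_smul, norm_mul, hu, one_mul]
  rw [← sq_eq_sq₀ (norm_nonneg _) (norm_nonneg _), WithLp.prod_norm_sq_eq_of_L2,
    WithLp.prod_norm_sq_eq_of_L2, WithLp.smul_fst, WithLp.smul_snd, h, h]

theorem codeLattice_le_baseZLattice (P : Ideal (𝓞 K)) (C : Submodule (𝓞 K ⧸ P) (CodeSpace P)) :
    codeLattice P C ≤ baseZLattice P := fun _ hx => ((mem_codeLattice P C _).mp hx).1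

theorem smul_mem_codeLattice {P : Ideal (𝓞 K)} {C : Submodule (𝓞 K ⧸ P) (CodeSpace P)}
    (r : 𝓞 K) {x : RealPlane K} (hx : x ∈ codeLattice P C) : r • x ∈ codeLattice P C := by
  obtain ⟨h, h'⟩ := (mem_codeLattice P C x).mp hx
  exact (mem_codeLattice P C _).mpr ⟨(baseLattice P).smul_mem r h,
    C.smul_mem (Ideal.Quotient.mk P r) h'⟩

theorem relIndex_codeLattice (P : Ideal (𝓞 K)) (C : Submodule (𝓞 K ⧸ P) (CodeSpace P)) :
    (codeLattice P C).toAddSubgroup.relIndex (baseZLattice P).toAddSubgroup =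
      C.toAddSubgroup.index := by
  let π : baseLattice P →+ CodeSpace P :=
    (P • (⊤ : Submodule (𝓞 K) (baseLattice P))).mkQ.toAddMonoidHom
  let J : AddSubgroup (baseLattice P) := C.toAddSubgroup.comap π
  have hJ : (codeLattice P C).toAddSubgroup.addSubgroupOf (baseZLattice P).toAddSubgroup = J :=
    AddSubgroup.ext fun x =>
      (mem_codeLattice P C _).trans ⟨fun ⟨_, h⟩ => h, fun h => ⟨x.2, h⟩⟩
  exact (congrArg AddSubgroup.index hJ).trans <|
    AddSubgroup.index_comap_of_surjective (f := π) _ (Submodule.mkQ_surjective _)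

variable {c : K →+* K} (hc : ∀ (τ : K →+* ℂ) (a : K), τ (c a) = conj (τ a))
include hc

/-- Round along the vectors (bᵢ, 0) and (0, a·bᵢ), suitably scaled, where a is a Minkowski element
of P⁻¹D. Since |τ(bᵢ)| = 1, multiplying by bᵢ costs nothing. The squared lengths are at most
n/q^(1/n) and 9n/q^(1/n), and n(n + 9n)/4 = 5n²/2. -/
theorem exists_norm_sub_baseZLattice_le {P : Ideal (𝓞 K)} (hP : P ≠ ⊥) {ι : Type*} [Fintype ι]
    (b : Basis ι ℚ K) (hb : ∀ i, IsIntegral ℤ (b i)) (hb1 : ∀ i (τ : K →+* ℂ), ‖τ (b i)‖ = 1)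
    {ρ : ℝ} (hρ0 : 0 ≤ ρ) (hρ : 5 * (finrank ℚ K : ℝ) ^ 2 /
      (2 * (residueCard P : ℝ) ^ (1 / (finrank ℚ K : ℝ))) ≤ ρ ^ 2) (x : RealPlane K) :
    ∃ v ∈ baseZLattice P, ‖x - v‖ ≤ ρ := by
  have hP' : (P : FractionalIdeal (𝓞 K)⁰ K) ≠ 0 := coeIdeal_ne_zero.mpr hP
  have hq : (0 : ℝ) < residueCard P := by exact_mod_cast residueCard_pos hP
  have hd1 := one_le_abs_discr (K := K)
  have hd : (0 : ℝ) < |(NumberField.discr K : ℝ)| := one_pos.trans_le hd1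
  have hn : (0 : ℝ) < finrank ℚ K := by exact_mod_cast finrank_pos
  have hα := (scalingFactor_pos hP).ne'
  have hcard : (Fintype.card (K →+* ℂ) : ℝ) = finrank ℚ K := by
    rw [NumberField.Embeddings.card]
  obtain ⟨a, ha, ha0, haτ⟩ := exists_ne_zero_mem_forall_norm_le
    (I := (P : FractionalIdeal (𝓞 K)⁰ K)⁻¹ * codifferent K)
    (mul_ne_zero (inv_ne_zero hP') codifferent_ne_zero)
  have hN : ((absNorm ((P : FractionalIdeal (𝓞 K)⁰ K)⁻¹ * codifferent K) : ℚ) : ℝ) =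
      (residueCard P * |(NumberField.discr K : ℝ)|)⁻¹ := by
    rw [map_mul, map_inv₀, absNorm_coe_eq_residueCard, absNorm_codifferent]
    push_cast
    rw [mul_inv]
  rw [hN] at haτ
  let v : ι ⊕ ι → RealPlane K :=
    Sum.elim (fun i => scaledPoint P (b i) 0) fun i => scaledPoint P 0 (a * b i)
  have hbO : ∀ i, b i ∈ (1 : FractionalIdeal (𝓞 K)⁰ K) := fun i =>
    (mem_one_iff _).mpr ⟨⟨b i, hb i⟩, rfl⟩
  refine exists_mem_norm_sub_le (v := v) ?_ ?_ hρ0 (le_trans ?_ hρ) x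
  · rintro (i | i)
    · exact (mem_baseLattice hc P _).mpr ⟨_, hbO i, 0, zero_mem _, rfl⟩
    · refine (mem_baseLattice hc P _).mpr ⟨0, zero_mem _, a * b i, ?_, rfl⟩
      rw [← mul_one ((P : FractionalIdeal (𝓞 K)⁰ K)⁻¹ * codifferent K)]
      exact mul_mem_mul ha (hbO i)
  · set S := Submodule.span ℝ (Set.range v)
    let i₁ : RealSpace K →ₗ[ℝ] RealPlane K :=
      (WithLp.linearEquiv 2 ℝ _).symm.toLinearMap ∘ₗ LinearMap.inl ℝ _ _
    let i₂ : RealSpace K →ₗ[ℝ] RealPlane K :=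
      (WithLp.linearEquiv 2 ℝ _).symm.toLinearMap ∘ₗ LinearMap.inr ℝ _ _
    have h1 : S.comap i₁ = ⊤ := by
      rw [eq_top_iff, ← (realBasis b).span_eq, Submodule.span_le]
      rintro _ ⟨i, rfl⟩
      have h := S.smul_mem (scalingFactor P) (Submodule.subset_span ⟨Sum.inl i, rfl⟩)
      change scalingFactor P • scaledPoint P (b i) 0 ∈ S at h
      rw [scaledPoint, map_zero, smul_zero, ← WithLp.toLp_smul, Prod.smul_mk, smul_smul,
        mul_inv_cancel₀ hα, one_smul, smul_zero] at h
      rw [realBasis_apply]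
      exact h
    have h2 : S.comap i₂ = ⊤ := by
      let e : K ≃ₗ[ℚ] K := LinearEquiv.smulOfNeZero K K a ha0 |>.restrictScalars ℚ
      rw [eq_top_iff, ← (realBasis (b.map e)).span_eq, Submodule.span_le]
      rintro _ ⟨i, rfl⟩
      have h := S.smul_mem (scalingFactor P)⁻¹ (Submodule.subset_span ⟨Sum.inr i, rfl⟩)
      change (scalingFactor P)⁻¹ • scaledPoint P 0 (a * b i) ∈ S at h
      rw [scaledPoint, map_zero, smul_zero, ← WithLp.toLp_smul, Prod.smul_mk, smul_smul,
        inv_mul_cancel₀ hα, one_smul, smul_zero] at h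
      rw [realBasis_apply]
      exact h
    rw [eq_top_iff]
    intro x _
    have hx : x = i₁ x.fst + i₂ x.snd := by
      refine WithLp.ofLp_injective 2 (Prod.ext ?_ ?_) <;> simp [i₁, i₂]
    rw [hx]
    exact S.add_mem (h1.symm ▸ Submodule.mem_top : x.fst ∈ S.comap i₁)
      (h2.symm ▸ Submodule.mem_top : x.snd ∈ S.comap i₂)
  · have hcardι : (Fintype.card ι : ℝ) = finrank ℚ K := by
      rw [finrank_eq_card_basis b]
    set q := (residueCard P : ℝ) with hq_def
    set d := |(NumberField.discr K : ℝ)| with hd_def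
    set n := (finrank ℚ K : ℝ) with hn_def
    have hqn : 0 < q ^ (1 / n) := Real.rpow_pos_of_pos hq _
    have hdn : 0 < d ^ (1 / n) := Real.rpow_pos_of_pos hd _
    have hdn1 : 1 ≤ d ^ (1 / n) := Real.one_le_rpow hd1 (by positivity)
    have hsq : ((q * d)⁻¹ * √d) ^ (1 / n) * ((q * d)⁻¹ * √d) ^ (1 / n) =
        (q ^ (1 / n))⁻¹ * (q ^ (1 / n))⁻¹ * (d ^ (1 / n))⁻¹ := by
      rw [← Real.mul_rpow (by positivity) (by positivity), ← Real.inv_rpow hq.le,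
        ← Real.inv_rpow hd.le, ← Real.mul_rpow (by positivity) (by positivity),
        ← Real.mul_rpow (by positivity) (by positivity)]
      congr 1
      have h := Real.mul_self_sqrt hd.le
      calc (q * d)⁻¹ * √d * ((q * d)⁻¹ * √d) = (q * d)⁻¹ * (q * d)⁻¹ * (√d * √d) := by ring
        _ = _ := by rw [h]; field_simp
    have hv1 : ∀ i, ‖v (Sum.inl i)‖ ^ 2 ≤ n / q ^ (1 / n) := by
      intro i
      change ‖scaledPoint P (b i) 0‖ ^ 2 ≤ _
      rw [norm_scaledPoint_sq, scalingFactor_sq, norm_sq]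
      simp only [embed_algebraMap, hb1, one_pow, Finset.sum_const, Finset.card_univ, nsmul_eq_mul,
        mul_one, hcard, map_zero, norm_zero]
      rw [Real.mul_rpow hq.le hd.le, ← hn_def]
      calc _ = n / q ^ (1 / n) * (d ^ (1 / n))⁻¹ := by field_simp; ring
        _ ≤ n / q ^ (1 / n) * 1 :=
          mul_le_mul_of_nonneg_left (inv_le_one_of_one_le₀ hdn1) (by positivity)
        _ = _ := mul_one _
    have hv2 : ∀ i, ‖v (Sum.inr i)‖ ^ 2 ≤ 9 * n / q ^ (1 / n) := by
      intro i
      change ‖scaledPoint P 0 (a * b i)‖ ^ 2 ≤ _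
      rw [norm_scaledPoint_sq, scalingFactor_sq, norm_sq (algebraMap K (RealSpace K) (a * b i))]
      have h1 : ∑ τ : K →+* ℂ, ‖embed τ (algebraMap K (RealSpace K) (a * b i))‖ ^ 2 ≤
          n * (9 * ((q ^ (1 / n))⁻¹ * (q ^ (1 / n))⁻¹ * (d ^ (1 / n))⁻¹)) := by
        rw [← hcard, ← nsmul_eq_mul, ← Finset.card_univ]
        refine Finset.sum_le_card_nsmul _ _ _ fun τ _ => ?_
        rw [Finset.card_univ, hcard]
        rw [embed_algebraMap, map_mul, norm_mul, hb1, mul_one]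
        calc ‖τ a‖ ^ 2 ≤ (3 * ((q * d)⁻¹ * √d) ^ (1 / n)) ^ 2 :=
              pow_le_pow_left₀ (norm_nonneg _) (haτ τ) 2
          _ = 9 * (((q * d)⁻¹ * √d) ^ (1 / n) * ((q * d)⁻¹ * √d) ^ (1 / n)) := by ring
          _ = _ := by rw [hsq]
      rw [map_zero, norm_zero, ← hn_def, ← hq_def, ← hd_def, Real.mul_rpow hq.le hd.le]
      calc _ ≤ (q ^ (1 / n) * d ^ (1 / n))⁻¹ * 0 ^ 2 + q ^ (1 / n) * d ^ (1 / n) *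
            (n * (9 * ((q ^ (1 / n))⁻¹ * (q ^ (1 / n))⁻¹ * (d ^ (1 / n))⁻¹))) := by gcongr
        _ = _ := by field_simp; ring
    rw [Fintype.sum_sum_type]
    have h1 := Finset.sum_le_card_nsmul Finset.univ _ _ fun i _ => hv1 i
    have h2 := Finset.sum_le_card_nsmul Finset.univ _ _ fun i _ => hv2 i
    rw [Finset.card_univ, nsmul_eq_mul, hcardι] at h1 h2
    calc _ ≤ (n * (n / q ^ (1 / n)) + n * (9 * n / q ^ (1 / n))) / 4 := by linarith
      _ = _ := by field_simp; ring

end Averaging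

/-! ### Averaging over the lines -/

section LineCounting

open FractionalIdeal nonZeroDivisors RealSpace Module
open scoped LinearAlgebra.Projectivization

variable {K : Type*} [Field K] [NumberField K] {c : K →+* K}
  (hc : ∀ (τ : K →+* ℂ) (a : K), τ (c a) = conj (τ a))
include hc

theorem nontrivial_codeSpace {P : Ideal (𝓞 K)} (hP : P ≠ ⊥) (hPp : P.IsPrime) :
    Nontrivial (CodeSpace P) := by
  have h10 : scaledPoint P 1 0 ∈ baseLattice P :=
    (mem_baseLattice hc P _).mpr ⟨1, one_mem_one _, 0, zero_mem _, rfl⟩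
  refine ⟨⟨Submodule.Quotient.mk ⟨_, h10⟩, 0, fun h => ?_⟩⟩
  rw [Submodule.Quotient.mk_eq_zero] at h
  obtain ⟨a, ha, b, -, hab⟩ := (mem_smul_baseLattice hc hP _).mp h
  rw [← (scaledPoint_injective hP hab).1] at ha
  obtain ⟨p, hp, hp1⟩ := (mem_coeIdeal _).mp ha
  have h1 : p = 1 := by
    apply FaithfulSMul.algebraMap_injective (𝓞 K) K
    rw [hp1, map_one]
  exact hPp.ne_top ((Ideal.eq_top_iff_one P).mpr (h1 ▸ hp))

theorem exists_finrank_eq_one {P : Ideal (𝓞 K)} (hP : P ≠ ⊥) (hPp : P.IsPrime) :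
    ∃ C : Submodule (𝓞 K ⧸ P) (CodeSpace P), finrank (𝓞 K ⧸ P) C = 1 := by
  have := hPp.isMaximal hP
  let _ : Field (𝓞 K ⧸ P) := Ideal.Quotient.field P
  have := nontrivial_codeSpace hc hP hPp
  obtain ⟨v, hv⟩ := exists_ne (0 : CodeSpace P)
  exact ⟨_, finrank_span_singleton (K := 𝓞 K ⧸ P) hv⟩

/-- Since q ∈ P, qΛ₀ lies in any Λ_C; thus Λ₀ pairs integrally with q times the dual of Λ_C, which
still spans. -/
theorem isEuclideanLattice_baseZLattice {P : Ideal (𝓞 K)} (hP : P ≠ ⊥) (hPp : P.IsPrime) :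
    IsEuclideanLattice (baseZLattice P) := by
  obtain ⟨C, hC⟩ := exists_finrank_eq_one hc hP hPp
  obtain ⟨⟨hd, hs⟩, σ, hσ, -⟩ := isSymplecticLattice_codeLattice hc hP hPp hC
  have hq : (residueCard P : ℝ) ≠ 0 := by exact_mod_cast (residueCard_pos hP).ne'
  have hmul : ∀ x ∈ baseZLattice P, (residueCard P : ℝ) • x ∈ codeLattice P C := by
    intro x hx
    have h1 : (residueCard P : ℝ) • x = (residueCard P : 𝓞 K) • x := by
      rw [Nat.cast_smul_eq_nsmul, Nat.cast_smul_eq_nsmul]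
    have h2 : (residueCard P : 𝓞 K) ∈ P := Ideal.absNorm_mem P
    rw [h1]
    refine (mem_codeLattice P C _).mpr ⟨(baseLattice P).smul_mem _ hx, ?_⟩
    have h3 := Submodule.smul_mem_smul h2
      (Submodule.mem_top (x := (⟨x, hx⟩ : baseLattice P)) (R := 𝓞 K))
    rw [← Submodule.Quotient.mk_eq_zero] at h3
    have h4 : (Submodule.Quotient.mk ((residueCard P : 𝓞 K) • (⟨x, hx⟩ : baseLattice P)) :
        CodeSpace P) ∈ C := h3 ▸ C.zero_mem
    exact h4
  refine ⟨discreteTopology_of_inner_int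
    (M := (residueCard P : ℝ) • (dualLattice (codeLattice P C) : Set (RealPlane K))) ?_ ?_, ?_⟩
  · rw [Submodule.span_smul_eq_of_isUnit _ _ (IsUnit.mk0 _ hq), ← hσ]
    have h := (Submodule.span_image σ.toLinearEquiv.toLinearMap
      (s := (codeLattice P C : Set (RealPlane K))))
    rw [hs, Submodule.map_top, LinearEquiv.range] at h
    exact h
  · rintro x hx _ ⟨y, hy, rfl⟩
    obtain ⟨k, hk⟩ := hy _ (hmul x hx)
    refine ⟨k, ?_⟩
    rw [← hk, real_inner_comm]
    simp only [real_inner_smul_left, real_inner_smul_right]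
  · rw [eq_top_iff, ← hs]
    exact Submodule.span_mono (codeLattice_le_baseZLattice P C)

theorem exists_lineLattice_forall_lt_norm {P : Ideal (𝓞 K)} (hP : P ≠ ⊥) (hPp : P.IsPrime)
    {m : ℕ} (hm : 0 < m) {ζ : 𝓞 K} (hζ : IsPrimitiveRoot ζ m) {r ρ : ℝ}
    (hcov : ∀ x : RealPlane K, ∃ v ∈ baseZLattice P, ‖x - v‖ ≤ ρ)
    (hr : r ^ 2 < (finrank ℚ K : ℝ) * ((residueCard P : ℝ) ^ (1 / (finrank ℚ K : ℝ)) /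
      |(NumberField.discr K : ℝ)| ^ (1 / (finrank ℚ K : ℝ))))
    (hvol : (volume : Measure (RealPlane K)).real (Metric.closedBall 0 (r + ρ)) < m) :
    ∃ Λ ∈ lineLattices P, ∀ v ∈ Λ, v ≠ 0 → r < ‖v‖ := by
  classical
  have := hPp.isMaximal hP
  let _ : Field (𝓞 K ⧸ P) := Ideal.Quotient.field P
  have hFfin : Finite (𝓞 K ⧸ P) := finite_quotient hP
  obtain ⟨hdisc, hspan⟩ := isEuclideanLattice_baseZLattice hc hP hPp
  have : IsZLattice ℝ (baseZLattice P) := ⟨hspan⟩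
  have : Module.Finite ℤ (baseLattice P) := ZLattice.module_finite ℝ (baseZLattice P)
  have : Module.Finite (𝓞 K) (baseLattice P) := Module.Finite.of_restrictScalars_finite ℤ _ _
  have : Module.Finite (𝓞 K) (CodeSpace P) := inferInstance
  have : Module.Finite (𝓞 K ⧸ P) (CodeSpace P) := Module.Finite.of_restrictScalars_finite (𝓞 K) _ _
  have hVfin : Finite (CodeSpace P) := Module.finite_of_finite (𝓞 K ⧸ P)
  by_contra! hcon
  have hline : ∀ p : ℙ (𝓞 K ⧸ P) (CodeSpace P), ∃ v ∈ codeLattice P p.submodule,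
      v ≠ 0 ∧ ‖v‖ ≤ r := fun p => hcon _ ⟨p.submodule, p.finrank_submodule, rfl⟩
  choose v hv hv0 hvr using hline
  have hζnorm : ∀ (i : ℕ) (τ : K →+* ℂ), ‖τ ((ζ ^ i : 𝓞 K) : K)‖ = 1 := by
    intro i τ
    refine Complex.norm_eq_one_of_pow_eq_one (n := m) ?_ hm.ne'
    rw [← map_pow, ← map_pow, ← pow_mul, mul_comm i, pow_mul, hζ.pow_eq_one, one_pow, map_one,
      map_one]
  have hsmul_norm : ∀ (i : ℕ) (x : RealPlane K), ‖ζ ^ i • x‖ = ‖x‖ := fun i x => by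
    rw [← norm_smul_eq_norm (hζnorm i) x]
    rfl
  -- A short nonzero vector is too short for PΛ₀, so its class spans the line and determines it.
  have hne : ∀ (p : ℙ (𝓞 K ⧸ P) (CodeSpace P)) (x : RealPlane K) (hx : x ∈ baseLattice P),
      x ∈ codeLattice P p.submodule → x ≠ 0 → ‖x‖ ≤ r →
        (Submodule.Quotient.mk ⟨x, hx⟩ : CodeSpace P) ≠ 0 := by
    intro p x hx hxp hx0 hxr h0
    obtain ⟨a, ha, b, hb, hab⟩ :=
      (mem_smul_baseLattice hc hP _).mp ((Submodule.Quotient.mk_eq_zero _).mp h0)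
    change x = _ at hab
    have hab0 : a ≠ 0 ∨ b ≠ 0 := by
      by_contra! h
      exact hx0 (by rw [hab, h.1, h.2, scaledPoint_zero])
    have h1 := le_norm_scaledPoint_sq hP ha hb hab0
    rw [← hab] at h1
    exact absurd (hr.trans_le h1) (not_lt.mpr (pow_le_pow_left₀ (norm_nonneg _) hxr 2))
  let g : ℙ (𝓞 K ⧸ P) (CodeSpace P) × Fin m → RealPlane K := fun x => ζ ^ (x.2 : ℕ) • v x.1
  have hg_mem : ∀ x, g x ∈ codeLattice P x.1.submodule := fun x =>
    smul_mem_codeLattice _ (hv x.1)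
  have hg_norm : ∀ x, ‖g x‖ ≤ r := fun x => (hsmul_norm _ _).trans_le (hvr x.1)
  have hg0 : ∀ x, g x ≠ 0 := fun x h => hv0 x.1 (by
    rw [← norm_eq_zero, ← hsmul_norm x.2 (v x.1)]
    exact norm_eq_zero.mpr h)
  -- The vector determines its line p, hence v p; the powers of ζ with exponents below m are then
  -- separated because v p ≠ 0.
  have hg : Function.Injective g := by
    rintro ⟨p, i⟩ ⟨p', i'⟩ h
    have hbase : g (p, i) ∈ baseLattice P := codeLattice_le_baseZLattice _ _ (hg_mem (p, i))
    have hw := hne p _ hbase (hg_mem (p, i)) (hg0 _) (hg_norm _)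
    have hsub : ∀ p'' : ℙ (𝓞 K ⧸ P) (CodeSpace P), g (p, i) ∈ codeLattice P p''.submodule →
        Submodule.span (𝓞 K ⧸ P) {(Submodule.Quotient.mk ⟨_, hbase⟩ : CodeSpace P)} =
          p''.submodule := by
      intro p'' hp''
      obtain ⟨_, h1⟩ := (mem_codeLattice P _ _).mp hp''
      refine Submodule.eq_of_le_of_finrank_eq ((Submodule.span_singleton_le_iff_mem _ _).mpr h1) ?_
      rw [p''.finrank_submodule]
      exact finrank_span_singleton hw
    have hpp : p = p' := Projectivization.submodule_injective
      ((hsub p (hg_mem (p, i))).symm.trans (hsub p' (h ▸ hg_mem (p', i'))))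
    subst hpp
    have h1 : (((ζ ^ (i : ℕ) : 𝓞 K) : K) - ((ζ ^ (i' : ℕ) : 𝓞 K) : K)) • v p = 0 := by
      rw [sub_smul, sub_eq_zero]
      exact h
    have h2 : ((ζ ^ (i : ℕ) : 𝓞 K) : K) = ((ζ ^ (i' : ℕ) : 𝓞 K) : K) :=
      sub_eq_zero.mp ((smul_eq_zero.mp h1).resolve_right (hv0 p))
    exact Prod.ext rfl (Fin.ext (hζ.pow_inj i.2 i'.2 (NumberField.RingOfIntegers.ext h2)))
  have hfinP : Finite (ℙ (𝓞 K ⧸ P) (CodeSpace P)) := inferInstance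
  let _ := Fintype.ofFinite (ℙ (𝓞 K ⧸ P) (CodeSpace P))
  have hcount := card_mul_covolume_le (Λ := baseZLattice P) hcov (r := r)
    (s := Finset.univ.image g) (by
      intro w hw
      obtain ⟨x, -, rfl⟩ := Finset.mem_image.mp hw
      exact ⟨codeLattice_le_baseZLattice _ _ (hg_mem x), hg_norm x⟩)
  rw [Finset.card_image_of_injective _ hg, Finset.card_univ, Fintype.card_prod, Fintype.card_fin,
    ← Nat.card_eq_fintype_card] at hcount
  obtain ⟨C, hC⟩ := exists_finrank_eq_one hc hP hPp
  have hsymp := isSymplecticLattice_codeLattice hc hP hPp hC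
  have := hsymp.1.1
  have : IsZLattice ℝ (codeLattice P C) := ⟨hsymp.1.2⟩
  have hindex := ZLattice.covolume_div_covolume_eq_relIndex' (codeLattice P C) (baseZLattice P)
    (codeLattice_le_baseZLattice P C)
  rw [covolume_eq_one_of_isSymplecticLattice hsymp, relIndex_codeLattice] at hindex
  have hcardC : Nat.card C.toAddSubgroup = Nat.card (𝓞 K ⧸ P) := by
    have h := Module.natCard_eq_pow_finrank (K := 𝓞 K ⧸ P) (V := C)
    rw [hC, pow_one] at h
    exact h
  have hcardV := C.toAddSubgroup.card_mul_index
  rw [hcardC, Projectivization.card' (𝓞 K ⧸ P) (CodeSpace P)] at hcardV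
  have hcov0 := ZLattice.covolume_pos (baseZLattice P) volume
  set N := Nat.card (ℙ (𝓞 K ⧸ P) (CodeSpace P))
  set q := Nat.card (𝓞 K ⧸ P)
  set k := C.toAddSubgroup.index
  have hq : 1 < q := Finite.one_lt_card
  have hk0 : k ≠ 0 := by
    intro h
    rw [h, mul_zero] at hcardV
    omega
  -- The dimension of Λ₀/PΛ₀ is not needed: counting its elements through C and through all lines
  -- gives qk = N(q - 1) + 1, which forces k ≤ N.
  have hkN : k ≤ N := by
    obtain ⟨s, hs⟩ : ∃ s, q = s + 1 := ⟨q - 1, by omega⟩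
    rw [hs, Nat.add_sub_cancel] at hcardV
    have hs0 : 0 < s := by omega
    by_contra! h
    nlinarith [Nat.mul_le_mul_right s (Nat.succ_le_of_lt h)]
  have hkR : (k : ℝ) * ZLattice.covolume (baseZLattice P) = 1 := by
    rw [← hindex]
    field_simp
  have hkNR : (k : ℝ) ≤ N := by exact_mod_cast hkN
  have h1 : (1 : ℝ) ≤ N * ZLattice.covolume (baseZLattice P) := by
    rw [← hkR]
    exact mul_le_mul_of_nonneg_right hkNR hcov0.le
  have hmR : (0 : ℝ) < m := by exact_mod_cast hm
  push_cast at hcount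
  nlinarith [mul_le_mul_of_nonneg_left h1 hmR.le]

end LineCounting

/-! ### Choice of the radii, and a lower bound for the totient -/

section Asymptotic

open Real in
theorem exists_radius {ε : ℝ} (hε0 : 0 < ε) (hε1 : ε < 1) :
    ∃ C > 0, ∀ (n m : ℕ) (S : ℝ), 1 ≤ n → n ≤ m → 2 ≤ m → m ≤ 2 * n ^ 2 →
      (n : ℝ) ^ 2 * m ≤ C * S → ∃ r ρ : ℝ, 0 < r ∧ 0 ≤ ρ ∧
        r ^ (2 * n) * (π ^ n / (n.factorial : ℝ)) = (1 - ε / 2) * m ∧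
        (r + ρ) ^ (2 * n) * (π ^ n / (n.factorial : ℝ)) < m ∧
        5 * (n : ℝ) ^ 2 / (2 * S) ≤ ρ ^ 2 ∧ r ^ 2 < n * (S / m) := by
  have hc0 : 0 < 1 - ε / 2 := by linarith
  have hc1 : 1 - ε / 2 < 1 := by linarith
  have hη : 0 < -log (1 - ε / 2) / 2 := by
    have := log_neg hc0 hc1
    linarith
  set c := 1 - ε / 2 with hc
  -- With this η, c·exp η = √c < 1: the volume may grow by a factor exp η and remain below m.
  set η := -log c / 2 with hη_def
  have hexp : c * exp η < 1 := by
    have h1 : exp η < exp (-log c) := exp_lt_exp.mpr (by linarith)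
    rw [exp_neg, exp_log hc0] at h1
    calc c * exp η < c * c⁻¹ := mul_lt_mul_of_pos_left h1 hc0
      _ = 1 := mul_inv_cancel₀ hc0.ne'
  -- The bound η²/144 gives 2nρ/r ≤ η, using ρ² = 4n²/S, r² ≥ n/9 and n ≤ m. The bound 1/2 gives m²
  -- ≤ 2n²m ≤ S, needed for the upper bound on r².
  refine ⟨min (η ^ 2 / 144) (1 / 2), by positivity, fun n m S hn hnm hm2 hmn hS => ?_⟩
  have hnR : (1 : ℝ) ≤ n := by exact_mod_cast hn
  have hn0 : (0 : ℝ) < n := by linarith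
  have hm2R : (2 : ℝ) ≤ m := by exact_mod_cast hm2
  have hm0 : (0 : ℝ) < m := by linarith
  have hnmR : (n : ℝ) ≤ m := by exact_mod_cast hnm
  have hmnR : (m : ℝ) ≤ 2 * n ^ 2 := by exact_mod_cast hmn
  have hS0 : 0 < S := by
    have h : 0 < min (η ^ 2 / 144) (1 / 2) * S := lt_of_lt_of_le (by positivity) hS
    exact (pos_iff_pos_of_mul_pos h).mp (by positivity)
  have hS1 : (n : ℝ) ^ 2 * m ≤ η ^ 2 / 144 * S :=
    hS.trans (mul_le_mul_of_nonneg_right (min_le_left _ _) hS0.le)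
  have hS2 : (n : ℝ) ^ 2 * m ≤ 1 / 2 * S :=
    hS.trans (mul_le_mul_of_nonneg_right (min_le_right _ _) hS0.le)
  have hfac : (0 : ℝ) < n.factorial := by exact_mod_cast n.factorial_pos
  have hpow : ∀ x : ℝ, 0 ≤ x → (x ^ n) ^ (1 / (n : ℝ)) = x := fun x hx => by
    rw [one_div, pow_rpow_inv_natCast hx (by omega)]
  set A := (c * m * n.factorial) ^ (1 / (n : ℝ)) with hA
  have hA0 : 0 < A := by positivity
  have hAn : A ^ n = c * m * n.factorial := by
    rw [hA, one_div, rpow_inv_natCast_pow (by positivity) (by omega)]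
  -- From n! ≥ (n/e)ⁿ and cm ≥ 1, the latter because c > 1/2 and m ≥ 2.
  have hA_lower : n / exp 1 ≤ A := by
    rw [hA, ← hpow (n / exp 1) (by positivity)]
    refine rpow_le_rpow (by positivity) ?_ (by positivity)
    have h1 := pow_div_factorial_le_exp (n : ℝ) hn0.le n
    rw [div_le_iff₀ hfac] at h1
    have h2 : (1 : ℝ) ≤ c * m := by nlinarith
    rw [div_pow, div_le_iff₀ (by positivity), ← exp_nat_mul, mul_one]
    calc (n : ℝ) ^ n ≤ 1 * (exp n * n.factorial) := by rw [one_mul]; exact h1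
      _ ≤ c * m * (exp n * n.factorial) := by gcongr
      _ = _ := by ring
  have hA_upper : A ≤ m * n := by
    rw [hA, ← hpow (m * n) (by positivity)]
    refine rpow_le_rpow (by positivity) ?_ (by positivity)
    rw [mul_pow]
    have h1 : (n.factorial : ℝ) ≤ (n : ℝ) ^ n := by exact_mod_cast n.factorial_le_pow
    have h2 : c * m ≤ (m : ℝ) ^ n := by
      have h3 : (m : ℝ) ≤ (m : ℝ) ^ n := le_self_pow₀ (by linarith) (by omega)
      nlinarith
    gcongr
  have hr0 : 0 < √(A / π) := sqrt_pos.mpr (by positivity)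
  have hr2 : √(A / π) ^ 2 = A / π := sq_sqrt (by positivity)
  -- The covering bound asks only for 5/2 in place of 4; the square 4 keeps ρ simple.
  have hρ2 : (2 * n / √S) ^ 2 = 4 * n ^ 2 / S := by
    rw [div_pow, sq_sqrt hS0.le]; ring
  set r := √(A / π) with hr_def
  set ρ := 2 * n / √S with hρ_def
  have hρ0 : 0 ≤ ρ := by positivity
  have hvol : r ^ (2 * n) * (π ^ n / (n.factorial : ℝ)) = c * m := by
    rw [pow_mul, hr2, div_pow, hAn]
    field_simp
  have hr_lower : (n : ℝ) / 9 ≤ r ^ 2 := by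
    rw [hr2, le_div_iff₀ pi_pos]
    refine le_trans ?_ hA_lower
    rw [le_div_iff₀ (exp_pos 1)]
    have h1 := exp_one_lt_d9
    have h2 := pi_lt_d2
    have h3 := exp_pos 1
    have h4 : π * exp 1 ≤ 9 := by nlinarith [pi_pos]
    nlinarith
  refine ⟨r, ρ, hr0, hρ0, hvol, ?_, ?_, ?_⟩
  · have h1 : 2 * n * (ρ / r) ≤ η := by
      refine abs_le_of_sq_le_sq' ?_ hη.le |>.2
      rw [mul_pow, div_pow, hρ2, ← mul_div_assoc, div_le_iff₀ (by positivity)]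
      calc (2 * (n : ℝ)) ^ 2 * (4 * n ^ 2 / S) = 16 * n * (n ^ 2 * n) / S := by ring
        _ ≤ 16 * n * (η ^ 2 / 144 * S) / S :=
            div_le_div_of_nonneg_right (mul_le_mul_of_nonneg_left
              ((mul_le_mul_of_nonneg_left hnmR (by positivity)).trans hS1) (by positivity)) hS0.le
        _ = η ^ 2 * (n / 9) := by field_simp; ring
        _ ≤ η ^ 2 * r ^ 2 := by gcongr
    have h2 : (r + ρ) ^ (2 * n) ≤ r ^ (2 * n) * exp η := by
      have h3 : r + ρ = r * (1 + ρ / r) := by field_simp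
      rw [h3, mul_pow]
      gcongr
      calc (1 + ρ / r) ^ (2 * n) ≤ exp (ρ / r) ^ (2 * n) := by
            gcongr
            rw [add_comm]
            exact add_one_le_exp _
        _ = exp (2 * n * (ρ / r)) := by rw [← exp_nat_mul]; push_cast; ring_nf
        _ ≤ exp η := exp_le_exp.mpr h1
    calc _ ≤ r ^ (2 * n) * exp η * (π ^ n / (n.factorial : ℝ)) := by gcongr
      _ = c * exp η * m := by rw [mul_right_comm, hvol]; ring
      _ < 1 * m := mul_lt_mul_of_pos_right hexp hm0
      _ = m := one_mul _
  · rw [hρ2, div_le_div_iff₀ (by positivity) hS0]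
    have h := mul_pos (pow_pos hn0 2) hS0
    linarith
  · rw [hr2, div_lt_iff₀ pi_pos]
    refine hA_upper.trans_lt ?_
    have h1 : (m : ℝ) * m ≤ S := by
      have h := mul_le_mul_of_nonneg_right hmnR hm0.le
      linarith
    have h2 : (m : ℝ) ≤ S / m := (le_div_iff₀ hm0).mpr h1
    have h3 := pi_gt_three
    calc (m : ℝ) * n < m * n * π := by
          exact lt_mul_of_one_lt_right (by positivity) (by linarith)
      _ ≤ S / m * n * π := by gcongr
      _ = _ := by ring

/-- The factor 2 is lost only at the prime 2. The odd case is carried along because one of two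
coprime factors is odd, so the loss occurs at most once. -/
theorem le_two_mul_totient_sq (m : ℕ) :
    m ≤ 2 * m.totient ^ 2 ∧ (Odd m → m ≤ m.totient ^ 2) := by
  induction m using Nat.recOnPrimeCoprime with
  | zero => simp
  | prime_pow p n hp =>
    rcases n with _ | k
    · simp
    · rw [Nat.totient_prime_pow_succ hp, mul_pow]
      have hpk : 1 ≤ p ^ k := Nat.one_le_pow _ _ hp.pos
      have h1 : p ^ k ≤ (p ^ k) ^ 2 := Nat.le_self_pow two_ne_zero _
      obtain ⟨t, rfl⟩ : ∃ t, p = t + 2 := ⟨p - 2, by have := hp.two_le; omega⟩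
      have hsub : t + 2 - 1 = t + 1 := by omega
      rw [hsub, pow_succ]
      constructor
      · calc (t + 2) ^ k * (t + 2) ≤ ((t + 2) ^ k) ^ 2 * (2 * (t + 1) ^ 2) :=
              Nat.mul_le_mul h1 (by nlinarith)
          _ = _ := by ring
      · intro hodd
        have ht : 1 ≤ t := by
          by_contra! h
          obtain rfl : t = 0 := by omega
          exact absurd hodd (by simp)
        exact Nat.mul_le_mul h1 (by nlinarith)
  | coprime a b _ _ hab ha hb =>
    rw [Nat.totient_mul hab, mul_pow]
    have hodd : Odd a ∨ Odd b := by
      by_contra! h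
      rw [Nat.not_odd_iff_even, Nat.not_odd_iff_even] at h
      have := Nat.dvd_gcd h.1.two_dvd h.2.two_dvd
      rw [hab.gcd_eq_one] at this
      omega
    refine ⟨?_, fun h => Nat.mul_le_mul (ha.2 (Nat.odd_mul.mp h).1) (hb.2 (Nat.odd_mul.mp h).2)⟩
    rcases hodd with h | h
    · exact (Nat.mul_le_mul (ha.2 h) hb.1).trans_eq (by ring)
    · exact (Nat.mul_le_mul ha.1 (hb.2 h)).trans_eq (by ring)

end Asymptotic

/-! ### Assembly for cyclotomic fields -/

section Main

open RealSpace Module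

theorem finrank_realPlane (K : Type*) [Field K] [NumberField K] :
    finrank ℝ (RealPlane K) = 2 * finrank ℚ K := by
  rw [(WithLp.linearEquiv 2 ℝ (RealSpace K × RealSpace K)).finrank_eq, finrank_prod,
    RealSpace.finrank_eq, two_mul]

theorem volume_real_closedBall_of_dim_even {E : Type*} [NormedAddCommGroup E]
    [InnerProductSpace ℝ E] [FiniteDimensional ℝ E] [MeasurableSpace E] [BorelSpace E] {k : ℕ}
    (hk : 0 < k) (hE : finrank ℝ E = 2 * k) {r : ℝ} (hr : 0 ≤ r) :
    (volume : Measure E).real (Metric.closedBall 0 r) =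
      r ^ (2 * k) * (Real.pi ^ k / (k.factorial : ℝ)) := by
  have : Nontrivial E := Module.nontrivial_of_finrank_pos (R := ℝ) (by omega)
  rw [measureReal_def, InnerProductSpace.volume_closedBall_of_dim_even hE, ENNReal.toReal_mul,
    ENNReal.toReal_pow, ENNReal.toReal_ofReal hr, ENNReal.toReal_ofReal (by positivity), hE]

theorem le_latticeDensity {E : Type*} [NormedAddCommGroup E] [InnerProductSpace ℝ E]
    [FiniteDimensional ℝ E] [Nontrivial E] [MeasurableSpace E] [BorelSpace E] {Λ : Submodule ℤ E}
    (hΛ : IsSymplecticLattice Λ) {r : ℝ} (hr : ∀ v ∈ Λ, v ≠ 0 → r < ‖v‖) :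
    (volume : Measure E).real (Metric.closedBall 0 r) / 2 ^ finrank ℝ E ≤ latticeDensity Λ := by
  have hne : ∃ v ∈ Λ, v ≠ 0 := by
    by_contra! h
    have h1 : (Λ : Set E) ⊆ {0} := h
    have h2 := Submodule.span_mono (R := ℝ) h1
    rw [hΛ.1.2, Submodule.span_zero_singleton, top_le_iff] at h2
    exact bot_ne_top h2
  have hmin : r ≤ latticeMinimum Λ := by
    obtain ⟨v, hv, hv0⟩ := hne
    refine le_csInf ⟨‖v‖, v, hv, hv0, rfl⟩ ?_
    rintro _ ⟨w, hw, hw0, rfl⟩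
    exact (hr w hw hw0).le
  rw [latticeDensity, covolume_eq_one_of_isSymplecticLattice hΛ, mul_one]
  exact div_le_div_of_nonneg_right
    (measureReal_mono (μ := volume) (Metric.closedBall_subset_closedBall hmin)
      (Metric.isBounded_closedBall (x := (0 : E))).measure_lt_top.ne) (by positivity)

theorem ne_bot_of_liesOver {K : Type*} [Field K] [NumberField K] {P : Ideal (𝓞 K)} {p : ℕ}
    (hp : p.Prime) (h : P.LiesOver (Ideal.span {(p : ℤ)})) : P ≠ ⊥ := by
  rintro rfl
  have h1 := h.over
  have h2 : (p : ℤ) ∈ (⊥ : Ideal (𝓞 K)).under ℤ := h1 ▸ Ideal.mem_span_singleton_self _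
  rw [Ideal.under_def, Ideal.mem_comap, Ideal.mem_bot] at h2
  have h3 : (p : ℤ) = 0 := by
    apply FaithfulSMul.algebraMap_injective ℤ (𝓞 K)
    rw [h2, map_zero]
  exact hp.ne_zero (by exact_mod_cast h3)

theorem exists_lineLattice_latticeDensity_gt {m : ℕ} (hm : 2 < m) {K : Type*} [Field K]
    [NumberField K] [IsCyclotomicExtension {m} ℚ K] {P : Ideal (𝓞 K)} (hPp : P.IsPrime)
    (hP : P ≠ ⊥) {ε r ρ : ℝ} (hε : 0 < ε) (hr : 0 < r) (hρ : 0 ≤ ρ)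
    (hvol : r ^ (2 * m.totient) * (Real.pi ^ m.totient / (m.totient.factorial : ℝ)) =
      (1 - ε / 2) * m)
    (hvol' : (r + ρ) ^ (2 * m.totient) * (Real.pi ^ m.totient / (m.totient.factorial : ℝ)) < m)
    (hρ2 : 5 * (m.totient : ℝ) ^ 2 / (2 * (residueCard P : ℝ) ^ (1 / (m.totient : ℝ))) ≤ ρ ^ 2)
    (hr2 : r ^ 2 < m.totient * ((residueCard P : ℝ) ^ (1 / (m.totient : ℝ)) / m)) :
    finrank ℝ (RealPlane K) = 2 * m.totient ∧
      (∀ Λ ∈ lineLattices P, IsSymplecticLattice Λ) ∧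
      ∃ Λ ∈ lineLattices P, (1 - ε) * (m : ℝ) / 2 ^ (2 * m.totient) < latticeDensity Λ := by
  have : NeZero m := ⟨by omega⟩
  have hcm : NumberField.IsCMField K :=
    IsCyclotomicExtension.Rat.isCMField K (S := {m}) ⟨m, rfl, hm⟩
  have hc : ∀ (τ : K →+* ℂ) (a : K),
      τ ((NumberField.IsCMField.complexConj K : K →+* K) a) = conj (τ a) := fun τ a =>
    NumberField.IsCMField.complexEmbedding_complexConj K τ a
  have hfin : finrank ℚ K = m.totient := IsCyclotomicExtension.Rat.finrank m K
  have hE : finrank ℝ (RealPlane K) = 2 * m.totient := by rw [finrank_realPlane, hfin]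
  have hφ : 0 < m.totient := Nat.totient_pos.mpr (by omega)
  have : Nontrivial (RealPlane K) := Module.nontrivial_of_finrank_pos (R := ℝ) (by omega)
  have hsymp : ∀ Λ ∈ lineLattices P, IsSymplecticLattice Λ := by
    rintro _ ⟨C, hC, rfl⟩
    exact isSymplecticLattice_codeLattice hc hP hPp hC
  refine ⟨hE, hsymp, ?_⟩
  have hζ := IsCyclotomicExtension.zeta_spec m ℚ K
  have hτζ : ∀ τ : K →+* ℂ, ‖τ (IsCyclotomicExtension.zeta m ℚ K)‖ = 1 := fun τ =>
    Complex.norm_eq_one_of_pow_eq_one (n := m)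
      (by rw [← map_pow, hζ.pow_eq_one, map_one]) (by omega)
  have hbasis : ∀ i, (hζ.powerBasis ℚ).basis i = IsCyclotomicExtension.zeta m ℚ K ^ (i : ℕ) :=
    fun i => by rw [PowerBasis.basis_eq_pow, hζ.powerBasis_gen ℚ]
  -- The discriminant formula shows that |d_K| divides m^φ(m), so the root discriminant is at most
  -- m; this is the m in the bound on r².
  have hdisc : |(NumberField.discr K : ℝ)| ^ (1 / (m.totient : ℝ)) ≤ m := by
    have h1 : (NumberField.discr K).natAbs ≤ m ^ m.totient := by
      rw [IsCyclotomicExtension.Rat.natAbs_discr m K]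
      exact Nat.div_le_self _ _
    have h2 : |(NumberField.discr K : ℝ)| ≤ (m : ℝ) ^ m.totient := by
      rw [← Int.cast_abs, Int.abs_eq_natAbs]
      exact_mod_cast h1
    have h3 := Real.rpow_le_rpow (abs_nonneg _) h2 (by positivity : 0 ≤ 1 / (m.totient : ℝ))
    rwa [one_div, Real.pow_rpow_inv_natCast (by positivity) hφ.ne', ← one_div] at h3
  have hdisc0 : 0 < |(NumberField.discr K : ℝ)| ^ (1 / (m.totient : ℝ)) :=
    Real.rpow_pos_of_pos (one_pos.trans_le one_le_abs_discr) _
  obtain ⟨Λ, hΛ, hmin⟩ := exists_lineLattice_forall_lt_norm hc hP hPp (by omega : 0 < m)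
    (ζ := hζ.toInteger) hζ.toInteger_isPrimitiveRoot (r := r) (ρ := ρ)
    (exists_norm_sub_baseZLattice_le hc hP (hζ.powerBasis ℚ).basis
      (fun i => by rw [hbasis]; exact (hζ.isIntegral (by omega)).pow _)
      (fun i τ => by rw [hbasis, map_pow, norm_pow, hτζ, one_pow]) hρ (by rw [hfin]; exact hρ2))
    (by
      rw [hfin]
      refine hr2.trans_le ?_
      gcongr)
    (by rwa [volume_real_closedBall_of_dim_even hφ hE (by positivity)])
  refine ⟨Λ, hΛ, lt_of_lt_of_le ?_ (le_latticeDensity (hsymp Λ hΛ) hmin)⟩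
  rw [volume_real_closedBall_of_dim_even hφ hE hr.le, hvol, hE]
  have hm0 : (0 : ℝ) < m := by exact_mod_cast (by omega : 0 < m)
  -- Passing from 1 - ε/2 to 1 - ε yields the strict inequality.
  gcongr
  linarith

end Main

end

theorem mainTheorem5 (ε : ℝ) (hε0 : 0 < ε) (hε1 : ε < 1)
    (P : ∀ m : ℕ, Ideal (𝓞 (CyclotomicField m ℚ)))
    (hP : ∀ m : ℕ, 0 < m → (P m).IsPrime ∧
      ∃ p : ℕ, p.Prime ∧ ¬ p ∣ m ∧ (P m).LiesOver (Ideal.span {(p : ℤ)}))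
    (hq : (fun m : ℕ => (m.totient : ℝ) ^ 2 * (m : ℝ)) =o[atTop]
      fun m : ℕ => (residueCard (P m) : ℝ) ^ (1 / (m.totient : ℝ))) :
    ∀ᶠ m : ℕ in atTop,
      Module.finrank ℝ (RealPlane (CyclotomicField m ℚ)) = 2 * m.totient ∧
      (∀ Λ ∈ lineLattices (P m), IsSymplecticLattice Λ) ∧
      ∃ Λ ∈ lineLattices (P m),
        (1 - ε) * (m : ℝ) / 2 ^ (2 * m.totient) < latticeDensity Λ := by
  obtain ⟨C, hC, hradius⟩ := exists_radius hε0 hε1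
  filter_upwards [hq.bound hC, eventually_gt_atTop 2] with m hqm hm
  obtain ⟨hPp, p, hp, -, hpP⟩ := hP m (by omega)
  have hφ : 1 ≤ m.totient := Nat.totient_pos.mpr (by omega)
  have hbound : (m.totient : ℝ) ^ 2 * m ≤
      C * (residueCard (P m) : ℝ) ^ (1 / (m.totient : ℝ)) := by
    rwa [Real.norm_of_nonneg (by positivity), Real.norm_of_nonneg (by positivity)] at hqm
  obtain ⟨r, ρ, hr, hρ, hvol, hvol', hρ2, hr2⟩ := hradius m.totient m _ hφ m.totient_le (by omega)
    (le_two_mul_totient_sq m).1 hbound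
  have : NeZero m := ⟨by omega⟩
  -- The ℚ-algebra structure of a field of characteristic zero must be identified with the one built
  -- into `CyclotomicField`; they agree because such a structure is unique.
  have : @IsCyclotomicExtension {m} ℚ (CyclotomicField m ℚ) _ _ DivisionRing.toRatAlgebra := by
    rw [Subsingleton.elim DivisionRing.toRatAlgebra (CyclotomicField.algebra m ℚ)]
    exact CyclotomicField.isCyclotomicExtension m ℚ
  exact exists_lineLattice_latticeDensity_gt (K := CyclotomicField m ℚ) hm hPp
    (ne_bot_of_liesOver hp hpP) hε0 hr hρ hvol hvol' hρ2 hr2
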